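/- All algebras are commutative real algebras, not assumed associative or unital. A pseudo-composition algebra is such an algebra $A$ with a non-zero symmetric bilinear form $\varphi$ satisfying $x^3=\varphi(x,x)x$ for all $x\in A$. Write $A_\mu(a)=\{x\in A: ax=\mu x\}$. An axis of $A$ is a non-zero idempotent $a$ with $A_1(a)=\mathbb{R}a$ and $A=A_1(a)\oplus A_{-1}(a)\oplus A_{1/2}(a)$ such that $$A_1A_1\subseteq A_1,\quad A_1A_{-1}\subseteq A_{-1},\quad A_1A_{1/2}\subseteq A_{1/2},\quad A_{-1}A_{-1}\subseteq A_1,\quad A_{-1}A_{1/2}\subseteq A_{1/2},\quad A_{1/2}A_{1/2}\subseteq A_1\oplus A_{-1},$$ where $A_\mu=A_\mu(a)$. Its Miyamoto involution $\tau_a$ is the automorphism of $A$ that is $+1$ on $A_1(a)\oplus A_{-1}(a)$ and $-1$ on $A_{1/2}(a)$. For $\alpha,\beta,\gamma,\psi\in\mathbb{R}$, a pseudo-composition algebra $(A,\varphi)$ generated by three axes $a,b,c$ has parameters $(\alpha,\beta,\gamma,\psi)$ if $\varphi(a,b)=\alpha$, $\varphi(b,c)=\beta$, $\varphi(a,c)=\gamma$,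 $\varphi(b,ac)=\psi$. It is called universal if for every pseudo-composition algebra $B$ generated by three axes $a',b',c'$ with the same parameters there is a surjective algebra homomorphism $A\to B$ with $a\mapsto a'$, $b\mapsto b'$, $c\mapsto c'$. **Proposition.** For all $\alpha,\beta,\gamma,\psi\in\mathbb{R}$ a universal axial pseudo-composition algebra $A$ over $\mathbb{R}$ generated by three axes $a,b,c$ with parameters $(\alpha,\beta,\gamma,\psi)$ exists, and for every such $A$ the following hold. 1. For no values of the parameters is the group $\langle\tau_a,\tau_b,\tau_c\rangle$ isomorphic to the alternating group $A_5$. 2. If $\alpha=\beta=\gamma=\tfrac14$ and $\psi=\tfrac5{32}$, then $\langle\tau_a,\tau_b,\tau_c\rangle\cong PSL(2,7)$. -/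

import Mathlib

universe u

namespace PCAlg

/-! Algebras here are commutative, real and in general neither associative nor unital. -/

section Basic

variable {A : Type u} [NonUnitalNonAssocCommRing A] [Module ℝ A]
  [IsScalarTower ℝ A A] [SMulCommClass ℝ A A]

/-- `A` is a pseudo-composition algebra with respect to `φ`: the form `φ` is a non-zero symmetric
bilinear form and `x ^ 3 = φ (x, x) x` for every `x`. -/
structure IsPseudoComposition (φ : LinearMap.BilinForm ℝ A) : Prop where
  form_ne_zero : φ ≠ 0
  form_symm : ∀ x y, φ x y = φ y x
  cube : ∀ x : A, x * (x * x) = φ x x • x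

/-- The eigenspace `A_μ(a)` of multiplication by `a`. -/
def eig (a : A) (μ : ℝ) : Submodule ℝ A :=
  Module.End.eigenspace (LinearMap.mulLeft ℝ a) μ

theorem mem_eig {a : A} {μ : ℝ} {x : A} : x ∈ eig a μ ↔ a * x = μ • x := by
  simp [eig]

/-- `a` is a (primitive) axis for the fusion law `PC(-1)`: a non-zero idempotent whose
`1`-eigenspace is the line through `a`, for which `A` is the (automatically direct) sum
of the eigenspaces for `1`, `-1` and `1/2`, and whose eigenvectors multiply according to the
fusion law. -/
structure IsAxis (a : A) : Prop where
  idem : a * a = a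
  ne_zero : a ≠ 0
  primitive : eig a 1 = Submodule.span ℝ {a}
  decomp : eig a 1 ⊔ eig a (-1) ⊔ eig a (1 / 2) = ⊤
  fusion_one_one : ∀ x ∈ eig a 1, ∀ y ∈ eig a 1, x * y ∈ eig a 1
  fusion_one_neg : ∀ x ∈ eig a 1, ∀ y ∈ eig a (-1), x * y ∈ eig a (-1)
  fusion_one_half : ∀ x ∈ eig a 1, ∀ y ∈ eig a (1 / 2), x * y ∈ eig a (1 / 2)
  fusion_neg_neg : ∀ x ∈ eig a (-1), ∀ y ∈ eig a (-1), x * y ∈ eig a 1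
  fusion_neg_half : ∀ x ∈ eig a (-1), ∀ y ∈ eig a (1 / 2), x * y ∈ eig a (1 / 2)
  fusion_half_half : ∀ x ∈ eig a (1 / 2), ∀ y ∈ eig a (1 / 2), x * y ∈ eig a 1 ⊔ eig a (-1)

/-- The even part `A_1(a) ⊕ A_{-1}(a)` and the odd part `A_{1/2}(a)` are complementary. -/
theorem IsAxis.isCompl {a : A} (h : IsAxis a) :
    IsCompl (eig a 1 ⊔ eig a (-1)) (eig a (1 / 2)) := by
  refine ⟨?_, codisjoint_iff.mpr h.decomp⟩
  rw [Submodule.disjoint_def]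
  intro z hz hz'
  obtain ⟨x, hx, y, hy, rfl⟩ := Submodule.mem_sup.mp hz
  rw [mem_eig] at hx hy hz'
  have h1 : x - y = (1 / 2 : ℝ) • (x + y) := by
    rw [← hz', mul_add, hx, hy]; module
  have h2 : x = (3 : ℝ) • y := by
    have : (1 / 2 : ℝ) • x = (1 / 2 : ℝ) • ((3 : ℝ) • y) := by
      linear_combination (norm := module) h1
    exact smul_right_injective A (by norm_num : (1 / 2 : ℝ) ≠ 0) this
  have h3 : y = 0 := by
    have h4 : (3 : ℝ) • y = -((3 : ℝ) • y) := by
      have := hx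
      rw [h2, mul_smul_comm, hy] at this
      linear_combination (norm := module) -this
    have h5 : (6 : ℝ) • y = 0 := by linear_combination (norm := module) h4
    exact (smul_eq_zero.mp h5).resolve_left (by norm_num)
  rw [h2, h3]; simp

/-- The Miyamoto involution as a linear map: `b₊ + b₋ ↦ b₊ - b₋` with `b₊ ∈ A_1(a) ⊕ A_{-1}(a)`
and `b₋ ∈ A_{1/2}(a)`. -/
noncomputable def miyamotoLin {a : A} (h : IsAxis a) : A →ₗ[ℝ] A :=
  Submodule.projection _ _ h.isCompl - Submodule.projection _ _ h.isCompl.symm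

theorem miyamotoLin_add {a : A} (h : IsAxis a) {x y : A}
    (hx : x ∈ eig a 1 ⊔ eig a (-1)) (hy : y ∈ eig a (1 / 2)) :
    miyamotoLin h (x + y) = x - y := by
  simp only [miyamotoLin, LinearMap.sub_apply, map_add]
  rw [Submodule.projection_apply_of_mem_left h.isCompl hx,
    Submodule.projection_apply_of_mem_left h.isCompl.symm hy,
    (Submodule.projection_apply_eq_zero_iff h.isCompl).mpr hy,
    (Submodule.projection_apply_eq_zero_iff h.isCompl.symm).mpr hx]
  simp [sub_eq_add_neg]

theorem miyamotoLin_involutive {a : A} (h : IsAxis a) :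
    Function.Involutive (miyamotoLin h) := by
  intro z
  obtain ⟨x, hx, y, hy, rfl⟩ := Submodule.mem_sup.mp
    (h.decomp ▸ Submodule.mem_top : z ∈ eig a 1 ⊔ eig a (-1) ⊔ eig a (1 / 2))
  rw [miyamotoLin_add h hx hy, sub_eq_add_neg, miyamotoLin_add h hx (neg_mem hy), sub_neg_eq_add]

/-- The Miyamoto involution `τ_a` of an axis `a`. -/
noncomputable def miyamoto {a : A} (h : IsAxis a) : A ≃ₗ[ℝ] A :=
  LinearEquiv.ofInvolutive (miyamotoLin h) (miyamotoLin_involutive h)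

/-- The Miyamoto involution is an automorphism of the algebra. -/
theorem miyamoto_mul {a : A} (h : IsAxis a) (u v : A) :
    miyamoto h (u * v) = miyamoto h u * miyamoto h v := by
  have split : ∀ z : A, ∃ x ∈ eig a 1 ⊔ eig a (-1), ∃ y ∈ eig a (1 / 2), x + y = z := fun z =>
    Submodule.mem_sup.mp (h.decomp ▸ Submodule.mem_top)
  have ee : ∀ x ∈ eig a 1 ⊔ eig a (-1), ∀ y ∈ eig a 1 ⊔ eig a (-1),
      x * y ∈ eig a 1 ⊔ eig a (-1) := by
    intro x hx y hy
    obtain ⟨x1, hx1, x2, hx2, rfl⟩ := Submodule.mem_sup.mp hx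
    obtain ⟨y1, hy1, y2, hy2, rfl⟩ := Submodule.mem_sup.mp hy
    have e1 := h.fusion_one_one x1 hx1 y1 hy1
    have e2 := h.fusion_one_neg x1 hx1 y2 hy2
    have e3 := h.fusion_one_neg y1 hy1 x2 hx2
    have e4 := h.fusion_neg_neg x2 hx2 y2 hy2
    rw [show (x1 + x2) * (y1 + y2) = (x1 * y1 + x2 * y2) + (x1 * y2 + y1 * x2) by
      rw [mul_comm y1 x2]; simp only [mul_add, add_mul]; abel]
    exact Submodule.add_mem_sup (add_mem e1 e4) (add_mem e2 e3)
  have eo : ∀ x ∈ eig a 1 ⊔ eig a (-1), ∀ y ∈ eig a (1 / 2), x * y ∈ eig a (1 / 2) := by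
    intro x hx y hy
    obtain ⟨x1, hx1, x2, hx2, rfl⟩ := Submodule.mem_sup.mp hx
    rw [add_mul]
    exact add_mem (h.fusion_one_half x1 hx1 y hy) (h.fusion_neg_half x2 hx2 y hy)
  obtain ⟨x, hx, y, hy, rfl⟩ := split u
  obtain ⟨x', hx', y', hy', rfl⟩ := split v
  change miyamotoLin h _ = miyamotoLin h _ * miyamotoLin h _
  rw [show (x + y) * (x' + y') = (x * x' + y * y') + (x * y' + x' * y) by
      rw [mul_comm x' y]; simp only [mul_add, add_mul]; abel,
    miyamotoLin_add h (add_mem (ee x hx x' hx') (h.fusion_half_half y hy y' hy'))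
      (add_mem (eo x hx y' hy') (eo x' hx' y hy)),
    miyamotoLin_add h hx hy, miyamotoLin_add h hx' hy', mul_comm x' y]
  simp only [mul_sub, sub_mul]; abel

/-- `A` is an axial pseudo-composition algebra with form `φ`, generated by the three axes
`a, b, c`, with parameters `α = (a, b)`, `β = (b, c)`, `γ = (a, c)` and `ψ = (b, ac)`. -/
structure IsThreeGenerated (φ : LinearMap.BilinForm ℝ A) (a b c : A) (α β γ ψ : ℝ) : Prop where
  pc : IsPseudoComposition φ
  axis_a : IsAxis a
  axis_b : IsAxis b
  axis_c : IsAxis c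
  gen : NonUnitalAlgebra.adjoin ℝ {a, b, c} = ⊤
  form_ab : φ a b = α
  form_bc : φ b c = β
  form_ac : φ a c = γ
  form_b_ac : φ b (a * c) = ψ

/-- `A` is the universal axial pseudo-composition algebra generated by the three axes `a, b, c`
with parameters `α, β, γ, ψ`: every axial pseudo-composition algebra generated by three axes with
the same parameters is a homomorphic image of it, generators going to generators. -/
structure IsUniversal (φ : LinearMap.BilinForm ℝ A) (a b c : A) (α β γ ψ : ℝ) : Prop
    extends IsThreeGenerated φ a b c α β γ ψ where
  universal : ∀ (B : Type u) [NonUnitalNonAssocCommRing B] [Module ℝ B]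
    [IsScalarTower ℝ B B] [SMulCommClass ℝ B B] (φ' : LinearMap.BilinForm ℝ B) (a' b' c' : B),
    IsThreeGenerated φ' a' b' c' α β γ ψ →
      ∃ f : A →ₙₐ[ℝ] B, Function.Surjective f ∧ f a = a' ∧ f b = b' ∧ f c = c'

/-- The group `⟨τ_a, τ_b, τ_c⟩`, inside the group of invertible linear maps of `A`. -/
noncomputable def tripleGroup {a b c : A} (ha : IsAxis a) (hb : IsAxis b) (hc : IsAxis c) :
    Subgroup (A ≃ₗ[ℝ] A) :=
  Subgroup.closure {miyamoto ha, miyamoto hb, miyamoto hc}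

end Basic

end PCAlg

/-! Linearizing x³ = φ(x, x)x at a non-zero idempotent e gives 2L² + L − 1 = 2φ(e, ·)e, where L is
multiplication by e. So L has only the eigenvalues 1, −1 and 1/2, the fusion law is automatic
(`isAxis`), L is self-adjoint for φ (`form_mul_left`), and τ_e has a closed formula in terms of the
product and the form (`miyamoto_apply`).

For three axes these relations close up on the monomials a, b, c, ab, bc, ac, a(bc), b(ac), so the
algebra has dimension at most eight. Explicit structure constants on ℝ⁸ satisfy the cubic identity
(`mulVec_cube`), so nothing collapses: this model is universal (`Model.isUniversal`), and it embeds
in every other universal algebra (`IsUniversal.eval_injective`).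

Against A₅: let e be an axis in the span of a, b, ab. If τ_e commuted with τ_c, then τ_e c would be
an axis with the same involution as c, hence equal to c (`eq_of_miyamoto_eq`). By linear
independence of monomials, however, c has coefficient −1/3 in τ_e c. Thus τ_c commutes with none of
the conjugates of τ_a, τ_b that arise from alternating words, and the same holds after cyclic
permutation. Any three elements of A₅ with trivial squares violate this
(`commutesDihedral_alternatingGroup`).

At the special parameters the three Miyamoto involutions permute 21 axes of the model. Three
involutions of PSL(2,7) permute its 21 involutions by conjugation through the same permutations.
Both actions are faithful, so both groups are the same permutation group
(`nonempty_closure_mulEquiv`). -/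

namespace PCAlg

/-! ### Linearized cubic identity and the eigenspaces of an idempotent. -/

section PseudoComposition

variable {A : Type*} [NonUnitalNonAssocCommRing A] [Module ℝ A]
  [IsScalarTower ℝ A A] [SMulCommClass ℝ A A] {φ : LinearMap.BilinForm ℝ A}

namespace IsPseudoComposition

/-- Half the difference of the cubic identity at x + y and at x − y keeps the terms of odd degree in
y; removing y³ leaves the part linear in y. -/
theorem polar_two (h : IsPseudoComposition φ) (x y : A) :
    (2 : ℝ) • (x * (x * y)) + y * (x * x) = (2 * φ x y) • x + φ x x • y := by
  have h1 := h.cube (x + y)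
  have h2 := h.cube (x - y)
  have h3 := h.cube y
  simp only [mul_add, add_mul, mul_sub, sub_mul, map_add, map_sub, LinearMap.add_apply,
    LinearMap.sub_apply, h.form_symm y x, mul_comm y x] at h1 h2
  linear_combination (norm := module) (1 / 2 : ℝ) • h1 - (1 / 2 : ℝ) • h2 - h3

/-- The full linearization of the identity `x ^ 3 = φ (x, x) x`. -/
theorem polar (h : IsPseudoComposition φ) (x y z : A) :
    x * (y * z) + y * (x * z) + z * (x * y) = φ x y • z + φ y z • x + φ x z • y := by
  have h1 := h.polar_two (x + y) z
  have h2 := h.polar_two x z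
  have h3 := h.polar_two y z
  simp only [mul_add, add_mul, map_add, LinearMap.add_apply, h.form_symm y x,
    mul_comm y x] at h1
  linear_combination (norm := module) (1 / 2 : ℝ) • (h1 - h2 - h3)

variable {e : A}

theorem form_idem (h : IsPseudoComposition φ) (he : e * e = e) (h0 : e ≠ 0) : φ e e = 1 := by
  have h1 := h.cube e
  rw [he, he] at h1
  have h2 : (φ e e - 1) • e = 0 := by linear_combination (norm := module) -h1
  linarith [(smul_eq_zero.mp h2).resolve_right h0]

/-- Modulo e this says (2L − 1)(L + 1) = 0 for multiplication L by e, which is where the eigenvalues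
1/2 and −1 come from. -/
theorem idem_sq (h : IsPseudoComposition φ) (he : e * e = e) (h0 : e ≠ 0) (x : A) :
    e * (e * x) = (1 / 2 : ℝ) • (x - e * x) + φ e x • e := by
  have h1 := h.polar_two e x
  rw [he, h.form_idem he h0, mul_comm x e] at h1
  linear_combination (norm := module) (1 / 2 : ℝ) • h1

/-- The cube of multiplication by e can be reduced in two ways, by `idem_sq` at ex or by e times
`idem_sq` at x; the results differ only in the coefficient of e. -/
theorem form_idem_mul (h : IsPseudoComposition φ) (he : e * e = e) (h0 : e ≠ 0) (x : A) :
    φ e (e * x) = φ e x := by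
  have h1 := h.idem_sq he h0 (e * x)
  have h2 := congrArg (e * ·) (h.idem_sq he h0 x)
  simp only [mul_add, mul_smul_comm, mul_sub, he] at h2
  have h3 : (φ e (e * x) - φ e x) • e = 0 := by linear_combination (norm := module) h2 - h1
  linarith [(smul_eq_zero.mp h3).resolve_right h0]

theorem form_eq_zero_of_neg (h : IsPseudoComposition φ) (he : e * e = e) (h0 : e ≠ 0) {x : A}
    (hx : e * x = -x) : φ e x = 0 := by
  have h1 := h.form_idem_mul he h0 x
  rw [hx, map_neg] at h1
  linarith

theorem form_eq_zero_of_half (h : IsPseudoComposition φ) (he : e * e = e) (h0 : e ≠ 0) {x : A}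
    (hx : e * x = (1 / 2 : ℝ) • x) : φ e x = 0 := by
  have h1 := h.form_idem_mul he h0 x
  rw [hx, map_smul, smul_eq_mul] at h1
  linarith

/-- A provisional fusion rule: the term in e disappears once `form_neg_half` shows that the two
eigenspaces are orthogonal. -/
theorem mul_neg_half (h : IsPseudoComposition φ) (he : e * e = e) (h0 : e ≠ 0) {x y : A}
    (hx : e * x = -x) (hy : e * y = (1 / 2 : ℝ) • y) :
    e * (x * y) = (1 / 2 : ℝ) • (x * y) + φ x y • e := by
  have h1 := h.polar e x y
  rw [hx, hy, h.form_eq_zero_of_neg he h0 hx, h.form_eq_zero_of_half he h0 hy, mul_smul_comm,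
    mul_neg, mul_comm y x] at h1
  linear_combination (norm := module) h1

/-- Linearization makes xy an eigenvector for 2 modulo e. Since 2 is not a root of 2t² + t − 1, the
product must be a multiple of e. -/
theorem mul_neg_neg (h : IsPseudoComposition φ) (he : e * e = e) (h0 : e ≠ 0) {x y : A}
    (hx : e * x = -x) (hy : e * y = -y) : x * y = -φ x y • e := by
  have h1 := h.polar e x y
  rw [hx, hy, h.form_eq_zero_of_neg he h0 hx, h.form_eq_zero_of_neg he h0 hy, mul_neg,
    mul_neg, mul_comm y x] at h1
  have h2 : e * (x * y) = (2 : ℝ) • (x * y) + φ x y • e := by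
    linear_combination (norm := module) h1
  have h3 := h.idem_sq he h0 (x * y)
  have h4 := h.form_idem_mul he h0 (x * y)
  simp only [h2, mul_add, mul_smul_comm, he, map_add, map_smul, smul_eq_mul,
    h.form_idem he h0] at h3 h4
  have h5 : φ e (x * y) = -φ x y := by linarith
  rw [h5] at h3
  linear_combination (norm := module) (2 / 9 : ℝ) • h3

theorem form_neg_half (h : IsPseudoComposition φ) (he : e * e = e) (h0 : e ≠ 0) {x y : A}
    (hx : e * x = -x) (hy : e * y = (1 / 2 : ℝ) • y) : φ x y = 0 := by
  have h1 := h.mul_neg_half he h0 hx hy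
  -- The shift by 2φ(x, y)e turns xy into an honest 1/2-eigenvector w, so `mul_neg_half` applies
  -- again to x and w. The linearized identity also gives xw as a combination of x and y; comparing
  -- the two forces a multiple of e to equal a multiple of x, and these have different eigenvalues.
  set w := x * y - (2 * φ x y) • e with hw
  have hxy : x * y = w + (2 * φ x y) • e := by rw [hw]; module
  have hew : e * w = (1 / 2 : ℝ) • w := by
    rw [hw, mul_sub, h1, mul_smul_comm, he]; module
  have h2 := h.mul_neg_half he h0 hx hew
  have h3 := h.polar_two x y
  rw [hxy, h.mul_neg_neg he h0 hx hx, mul_add, mul_smul_comm, mul_smul_comm, mul_comm x e, hx,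
    mul_comm y e, hy] at h3
  have h4 : x * w = (3 * φ x y) • x + (3 / 4 * φ x x) • y := by
    linear_combination (norm := module) (1 / 2 : ℝ) • h3
  rw [h4, mul_add, mul_smul_comm, mul_smul_comm, hx, hy] at h2
  have h5 : φ x w • e = (-(9 / 2) * φ x y) • x := by
    linear_combination (norm := module) -h2
  have h6 := congrArg (e * ·) h5
  simp only [mul_smul_comm, he, hx] at h6
  have h7 : φ x y • x = 0 := by
    linear_combination (norm := module) (-(1 / 9) : ℝ) • (h6 - h5)
  rcases smul_eq_zero.mp h7 with h8 | h8
  · exact h8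
  · simp [h8]

/-- The vector is three times the component of x in the (−1)-eigenspace; the one in `half_part` is
3/2 times the component for 1/2. -/
theorem neg_part (h : IsPseudoComposition φ) (he : e * e = e) (h0 : e ≠ 0) (x : A) :
    e * (x - (2 : ℝ) • (e * x) + φ e x • e) = -(x - (2 : ℝ) • (e * x) + φ e x • e) := by
  simp only [mul_add, mul_sub, mul_smul_comm, he, h.idem_sq he h0]
  module

theorem half_part (h : IsPseudoComposition φ) (he : e * e = e) (h0 : e ≠ 0) (x : A) :
    e * (x + e * x - (2 * φ e x) • e) = (1 / 2 : ℝ) • (x + e * x - (2 * φ e x) • e) := by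
  simp only [mul_add, mul_sub, mul_smul_comm, he, h.idem_sq he h0]
  module

/-- Multiplication by an idempotent is self-adjoint. -/
theorem form_mul_left (h : IsPseudoComposition φ) (he : e * e = e) (h0 : e ≠ 0) (x y : A) :
    φ (e * x) y = φ x (e * y) := by
  -- Orthogonality of the components is used with both assignments of x and y. In the difference,
  -- the terms symmetric in x and y cancel and three times the claim remains.
  have h1 := h.form_neg_half he h0 (h.neg_part he h0 x) (h.half_part he h0 y)
  have h2 := h.form_neg_half he h0 (h.neg_part he h0 y) (h.half_part he h0 x)
  simp only [map_add, map_sub, map_smul, LinearMap.add_apply, LinearMap.sub_apply,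
    LinearMap.smul_apply, smul_eq_mul, h.form_idem he h0, h.form_idem_mul he h0,
    h.form_symm _ e, h.form_symm y, h.form_symm (e * y)] at h1 h2
  linarith

/-- In a pseudo-composition algebra the axis condition is free for non-zero idempotents. This makes
the model's generators axes, and images of axes under automorphisms axes again. -/
theorem isAxis (h : IsPseudoComposition φ) (he : e * e = e) (h0 : e ≠ 0) : IsAxis e := by
  have one : ∀ x ∈ eig e 1, x = φ e x • e := by
    intro x hx
    rw [mem_eig, one_smul] at hx
    have h1 := h.idem_sq he h0 x
    rw [hx, hx] at h1
    linear_combination (norm := module) h1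
  have key : ∀ x : A, x ∈ eig e (-1) ↔ e * x = -x := by simp [mem_eig]
  have he1 : e ∈ eig e 1 := by rw [mem_eig, he, one_smul]
  refine ⟨he, h0, ?_, ?_, ?_, ?_, ?_, ?_, ?_, ?_⟩
  · refine le_antisymm (fun x hx => ?_) ?_
    · rw [one x hx]
      exact Submodule.smul_mem _ _ (Submodule.mem_span_singleton_self e)
    · rwa [Submodule.span_singleton_le_iff_mem]
  · rw [eq_top_iff]
    intro x _
    rw [show x = (φ e x • e + (1 / 3 : ℝ) • (x - (2 : ℝ) • (e * x) + φ e x • e)) +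
      (2 / 3 : ℝ) • (x + e * x - (2 * φ e x) • e) by module]
    refine Submodule.add_mem_sup (Submodule.add_mem_sup ?_ ?_) ?_
    · exact Submodule.smul_mem _ _ he1
    · exact Submodule.smul_mem _ _ ((key _).mpr (h.neg_part he h0 x))
    · exact Submodule.smul_mem _ _ (mem_eig.mpr (h.half_part he h0 x))
  · intro x hx y hy
    rw [one x hx, one y hy, smul_mul_smul_comm, he]
    exact Submodule.smul_mem _ _ he1
  · intro x hx y hy
    rw [one x hx, smul_mul_assoc, (key y).mp hy]
    exact Submodule.smul_mem _ _ (neg_mem hy)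
  · intro x hx y hy
    rw [one x hx, smul_mul_assoc, mem_eig.mp hy]
    exact Submodule.smul_mem _ _ (Submodule.smul_mem _ _ hy)
  · intro x hx y hy
    rw [h.mul_neg_neg he h0 ((key x).mp hx) ((key y).mp hy)]
    exact Submodule.smul_mem _ _ he1
  · intro x hx y hy
    rw [mem_eig, h.mul_neg_half he h0 ((key x).mp hx) (mem_eig.mp hy),
      h.form_neg_half he h0 ((key x).mp hx) (mem_eig.mp hy), zero_smul, add_zero]
  · intro x hx y hy
    rw [mem_eig] at hx hy
    have h1 := h.polar e x y
    rw [hx, hy, h.form_eq_zero_of_half he h0 hx, h.form_eq_zero_of_half he h0 hy, mul_smul_comm,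
      mul_smul_comm, mul_comm y x] at h1
    -- Linearization gives e(xy) = −xy + φ(x, y)e, so subtracting half of φ(x, y)e leaves a
    -- (−1)-eigenvector.
    rw [show x * y = (1 / 2 * φ x y) • e + (x * y - (1 / 2 * φ x y) • e) by module]
    refine Submodule.add_mem_sup (Submodule.smul_mem _ _ he1) ((key _).mpr ?_)
    rw [mul_sub, mul_smul_comm, he]
    linear_combination (norm := module) h1

theorem miyamoto_apply (h : IsPseudoComposition φ) (ha : IsAxis e) (x : A) :
    miyamoto ha x = -(1 / 3 : ℝ) • x - (4 / 3 : ℝ) • (e * x) + (8 / 3 * φ e x) • e := by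
  have he := ha.idem
  have h0 := ha.ne_zero
  have h1 := miyamotoLin_add ha
    (x := φ e x • e + (1 / 3 : ℝ) • (x - (2 : ℝ) • (e * x) + φ e x • e))
    (y := (2 / 3 : ℝ) • (x + e * x - (2 * φ e x) • e))
    (Submodule.add_mem_sup (Submodule.smul_mem _ _ (by rw [mem_eig, he, one_smul]))
      (Submodule.smul_mem _ _ (by rw [mem_eig, h.neg_part he h0, neg_one_smul])))
    (Submodule.smul_mem _ _ (mem_eig.mpr (h.half_part he h0 x)))
  rw [show (φ e x • e + (1 / 3 : ℝ) • (x - (2 : ℝ) • (e * x) + φ e x • e)) +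
      (2 / 3 : ℝ) • (x + e * x - (2 * φ e x) • e) = x by module] at h1
  change miyamotoLin ha x = _
  rw [h1]
  module

end IsPseudoComposition

end PseudoComposition

/-! ### The eight-dimensional model with explicit structure constants. -/

/-- The product of the model, in coordinates for `a, b, c, ab, bc, ac, a(bc), b(ac)`. -/
noncomputable def mulVec (α β γ ψ : ℝ) (x y : Fin 8 → ℝ) : Fin 8 → ℝ :=
  ![
    x 0 * y 0 + α * (x 0 * y 3 + x 3 * y 0) + γ * (x 0 * y 5 + x 5 * y 0)
    + ψ * (x 0 * y 6 + x 6 * y 0) + (-1 / 2 * ψ + 1 / 4 * β) * (x 0 * y 7 + x 7 * y 0)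
    + 1 / 2 * (x 1 * y 3 + x 3 * y 1) + 1 / 4 * β * (x 1 * y 6 + x 6 * y 1)
    + β * (x 2 * y 3 + x 3 * y 2) + 1 / 2 * (x 2 * y 5 + x 5 * y 2)
    + 3 / 4 * β * (x 2 * y 6 + x 6 * y 2) - 1 / 4 * β * (x 2 * y 7 + x 7 * y 2)
    + (-1 / 4 + 3 / 2 * α) * x 3 * y 3 + 3 / 4 * β * (x 3 * y 4 + x 4 * y 3)
    + (3 / 2 * ψ - 1 / 4 * β) * (x 3 * y 5 + x 5 * y 3)
    + (-3 / 4 * ψ + 3 / 4 * γ - 1 / 4 * β + 3 / 2 * α * β) * (x 3 * y 6 + x 6 * y 3)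
    + (3 / 4 * ψ - 1 / 4 * γ) * (x 3 * y 7 + x 7 * y 3) + 1 / 4 * β * (x 4 * y 5 + x 5 * y 4)
    + (1 / 4 - 1 / 4 * β + 1 / 2 * β ^ 2) * (x 4 * y 6 + x 6 * y 4)
    - 1 / 8 * (x 4 * y 7 + x 7 * y 4) + (-1 / 4 + 3 / 2 * γ) * x 5 * y 5
    + (-3 / 4 * ψ - 1 / 4 * β + 3 / 2 * β * γ + 3 / 4 * α) * (x 5 * y 6 + x 6 * y 5)
    + (-1 / 8 - 3 / 4 * ψ - 3 / 8 * γ + 1 / 8 * β - 3 / 2 * β * ψ + 9 / 4 * β * γ - 1 / 4 * β ^ 2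
      - 3 / 8 * α + 9 / 4 * α * β) * x 6 * y 6
    + (1 / 16 + 3 / 8 * ψ + 3 / 8 * γ + 1 / 16 * β + 3 / 4 * β * ψ - 7 / 8 * β * γ - 1 / 8 * β ^ 2
      - 3 / 8 * α * β) * (x 6 * y 7 + x 7 * y 6)
    + (1 / 16 - 3 / 8 * γ) * x 7 * y 7,
    1 / 2 * (x 0 * y 3 + x 3 * y 0) + 1 / 4 * γ * (x 0 * y 7 + x 7 * y 0) + x 1 * y 1
    + α * (x 1 * y 3 + x 3 * y 1) + β * (x 1 * y 4 + x 4 * y 1)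
    + (-1 / 2 * ψ + 1 / 4 * γ) * (x 1 * y 6 + x 6 * y 1) + ψ * (x 1 * y 7 + x 7 * y 1)
    + γ * (x 2 * y 3 + x 3 * y 2) + 1 / 2 * (x 2 * y 4 + x 4 * y 2)
    - 1 / 4 * γ * (x 2 * y 6 + x 6 * y 2) + 3 / 4 * γ * (x 2 * y 7 + x 7 * y 2)
    + (-1 / 4 + 3 / 2 * α) * x 3 * y 3 + (3 / 2 * ψ - 1 / 4 * γ) * (x 3 * y 4 + x 4 * y 3)
    + 3 / 4 * γ * (x 3 * y 5 + x 5 * y 3) + (3 / 4 * ψ - 1 / 4 * β) * (x 3 * y 6 + x 6 * y 3)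
    + (-3 / 4 * ψ - 1 / 4 * γ + 3 / 4 * β + 3 / 2 * α * γ) * (x 3 * y 7 + x 7 * y 3)
    + (-1 / 4 + 3 / 2 * β) * x 4 * y 4 + 1 / 4 * γ * (x 4 * y 5 + x 5 * y 4)
    + (-3 / 4 * ψ - 1 / 4 * γ + 3 / 2 * β * γ + 3 / 4 * α) * (x 4 * y 7 + x 7 * y 4)
    - 1 / 8 * (x 5 * y 6 + x 6 * y 5)
    + (1 / 4 - 1 / 4 * γ + 1 / 2 * γ ^ 2) * (x 5 * y 7 + x 7 * y 5)
    + (1 / 16 - 3 / 8 * β) * x 6 * y 6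
    + (1 / 16 + 3 / 8 * ψ + 1 / 16 * γ + 3 / 4 * γ * ψ - 1 / 8 * γ ^ 2 + 3 / 8 * β - 7 / 8 * β * γ
      - 3 / 8 * α * γ) * (x 6 * y 7 + x 7 * y 6)
    + (-1 / 8 - 3 / 4 * ψ + 1 / 8 * γ - 3 / 2 * γ * ψ - 1 / 4 * γ ^ 2 - 3 / 8 * β + 9 / 4 * β * γ
      - 3 / 8 * α + 9 / 4 * α * γ) * x 7 * y 7,
    1 / 2 * (x 0 * y 5 + x 5 * y 0) - 3 / 4 * α * (x 0 * y 7 + x 7 * y 0)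
    + 1 / 2 * (x 1 * y 4 + x 4 * y 1) - 3 / 4 * α * (x 1 * y 6 + x 6 * y 1) + x 2 * y 2
    + α * (x 2 * y 3 + x 3 * y 2) + β * (x 2 * y 4 + x 4 * y 2) + γ * (x 2 * y 5 + x 5 * y 2)
    + (-1 / 2 * ψ + 3 / 4 * α) * (x 2 * y 6 + x 6 * y 2)
    + (-1 / 2 * ψ + 3 / 4 * α) * (x 2 * y 7 + x 7 * y 2) + 3 / 4 * α * (x 3 * y 4 + x 4 * y 3)
    + 3 / 4 * α * (x 3 * y 5 + x 5 * y 3) - 1 / 8 * (x 3 * y 6 + x 6 * y 3)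
    - 1 / 8 * (x 3 * y 7 + x 7 * y 3) + (-1 / 4 + 3 / 2 * β) * x 4 * y 4
    + (3 / 2 * ψ - 3 / 4 * α) * (x 4 * y 5 + x 5 * y 4)
    + (3 / 4 * ψ - 1 / 4 * γ) * (x 4 * y 7 + x 7 * y 4) + (-1 / 4 + 3 / 2 * γ) * x 5 * y 5
    + (3 / 4 * ψ - 1 / 4 * β) * (x 5 * y 6 + x 6 * y 5) + (1 / 16 - 3 / 8 * β) * x 6 * y 6
    + (-1 / 8 - 3 / 8 * ψ + 3 / 16 * α - 9 / 4 * α * ψ + 3 / 8 * α * γ + 3 / 8 * α * β + 9 / 8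
      * α ^ 2) * (x 6 * y 7 + x 7 * y 6)
    + (1 / 16 - 3 / 8 * γ) * x 7 * y 7,
    (x 0 * y 1 + x 1 * y 0) - 1 / 2 * (x 0 * y 3 + x 3 * y 0)
    - 1 / 2 * γ * (x 0 * y 7 + x 7 * y 0) - 1 / 2 * (x 1 * y 3 + x 3 * y 1)
    - 1 / 2 * β * (x 1 * y 6 + x 6 * y 1) - 1 / 4 * (x 2 * y 6 + x 6 * y 2)
    - 1 / 4 * (x 2 * y 7 + x 7 * y 2) + (-1 / 2 - α) * x 3 * y 3
    - 1 / 2 * β * (x 3 * y 4 + x 4 * y 3) - 1 / 2 * γ * (x 3 * y 5 + x 5 * y 3)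
    + (-1 / 2 * ψ - 1 / 2 * β) * (x 3 * y 6 + x 6 * y 3)
    + (-1 / 2 * ψ - 1 / 2 * γ) * (x 3 * y 7 + x 7 * y 3) - 1 / 4 * (x 4 * y 5 + x 5 * y 4)
    + (1 / 8 - 3 / 4 * β) * (x 4 * y 6 + x 6 * y 4) - 1 / 4 * (x 4 * y 7 + x 7 * y 4)
    - 1 / 4 * (x 5 * y 6 + x 6 * y 5) + (1 / 8 - 3 / 4 * γ) * (x 5 * y 7 + x 7 * y 5)
    + (1 / 8 - 3 / 4 * β) * x 6 * y 6
    + (-1 / 16 + 3 / 4 * ψ + 3 / 8 * γ + 3 / 8 * β - 2 * β * γ - 3 / 8 * α) * (x 6 * y 7 + x 7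
      * y 6)
    + (1 / 8 - 3 / 4 * γ) * x 7 * y 7,
    1 / 2 * (x 0 * y 6 + x 6 * y 0) - 1 / 4 * (x 0 * y 7 + x 7 * y 0) + (x 1 * y 2 + x 2 * y 1)
    - 1 / 2 * (x 1 * y 4 + x 4 * y 1) + 3 / 2 * α * (x 1 * y 6 + x 6 * y 1)
    - 1 / 2 * (x 2 * y 4 + x 4 * y 2) + 3 / 2 * γ * (x 2 * y 6 + x 6 * y 2)
    - 1 / 2 * γ * (x 2 * y 7 + x 7 * y 2) - 1 / 2 * α * (x 3 * y 4 + x 4 * y 3)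
    - 1 / 4 * (x 3 * y 5 + x 5 * y 3) + (1 / 8 + 3 / 4 * α) * (x 3 * y 6 + x 6 * y 3)
    - 1 / 4 * (x 3 * y 7 + x 7 * y 3) + (-1 / 2 - β) * x 4 * y 4
    - 1 / 2 * γ * (x 4 * y 5 + x 5 * y 4) + ψ * (x 4 * y 6 + x 6 * y 4)
    + (-1 / 2 * ψ - 1 / 2 * γ) * (x 4 * y 7 + x 7 * y 4)
    + (1 / 8 + 3 / 4 * γ) * (x 5 * y 6 + x 6 * y 5)
    + (1 / 8 - 3 / 4 * γ) * (x 5 * y 7 + x 7 * y 5)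
    + (1 / 8 + 3 / 2 * ψ + 1 / 4 * β) * x 6 * y 6
    + (-1 / 16 - 3 / 4 * ψ + 3 / 8 * γ + 1 / 8 * β - 3 / 8 * α + 3 / 2 * α * γ) * (x 6 * y 7 + x 7
      * y 6)
    + (1 / 8 - 3 / 4 * γ) * x 7 * y 7,
    (x 0 * y 2 + x 2 * y 0) - 1 / 2 * (x 0 * y 5 + x 5 * y 0)
    + 3 / 2 * α * (x 0 * y 7 + x 7 * y 0) - 1 / 4 * (x 1 * y 6 + x 6 * y 1)
    + 1 / 2 * (x 1 * y 7 + x 7 * y 1) - 1 / 2 * (x 2 * y 5 + x 5 * y 2)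
    - 1 / 2 * β * (x 2 * y 6 + x 6 * y 2) + 3 / 2 * β * (x 2 * y 7 + x 7 * y 2)
    - 1 / 4 * (x 3 * y 4 + x 4 * y 3) - 1 / 2 * α * (x 3 * y 5 + x 5 * y 3)
    - 1 / 4 * (x 3 * y 6 + x 6 * y 3) + (1 / 8 + 3 / 4 * α) * (x 3 * y 7 + x 7 * y 3)
    - 1 / 2 * β * (x 4 * y 5 + x 5 * y 4) + (1 / 8 - 3 / 4 * β) * (x 4 * y 6 + x 6 * y 4)
    + (1 / 8 + 3 / 4 * β) * (x 4 * y 7 + x 7 * y 4) + (-1 / 2 - γ) * x 5 * y 5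
    + (-1 / 2 * ψ - 1 / 2 * β) * (x 5 * y 6 + x 6 * y 5) + ψ * (x 5 * y 7 + x 7 * y 5)
    + (1 / 8 - 3 / 4 * β) * x 6 * y 6
    + (-1 / 16 - 3 / 4 * ψ + 1 / 8 * γ + 3 / 8 * β - 3 / 8 * α + 3 / 2 * α * β) * (x 6 * y 7 + x 7
      * y 6)
    + (1 / 8 + 3 / 2 * ψ + 1 / 4 * γ) * x 7 * y 7,
    (x 0 * y 4 + x 4 * y 0) - 1 / 2 * (x 0 * y 6 + x 6 * y 0) + 1 / 2 * (x 0 * y 7 + x 7 * y 0)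
    + 1 / 2 * (x 1 * y 6 + x 6 * y 1) - (x 2 * y 3 + x 3 * y 2) - 1 / 2 * (x 2 * y 7 + x 7 * y 2)
    - 1 / 2 * (x 3 * y 5 + x 5 * y 3) + (1 / 4 - 1 / 2 * α) * (x 3 * y 6 + x 6 * y 3)
    + 1 / 2 * (x 4 * y 5 + x 5 * y 4) + (1 / 4 + 1 / 2 * β) * (x 4 * y 6 + x 6 * y 4)
    + (1 / 4 - 1 / 2 * γ) * (x 5 * y 6 + x 6 * y 5) + (1 / 4 - ψ + 1 / 2 * β) * x 6 * y 6
    + (-1 / 4 + ψ + 1 / 2 * γ - 1 / 4 * β - 3 / 4 * α) * (x 6 * y 7 + x 7 * y 6),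
    1 / 2 * (x 0 * y 7 + x 7 * y 0) + (x 1 * y 5 + x 5 * y 1) + 1 / 2 * (x 1 * y 6 + x 6 * y 1)
    - 1 / 2 * (x 1 * y 7 + x 7 * y 1) - (x 2 * y 3 + x 3 * y 2) - 1 / 2 * (x 2 * y 6 + x 6 * y 2)
    - 1 / 2 * (x 3 * y 4 + x 4 * y 3) + (1 / 4 - 1 / 2 * α) * (x 3 * y 7 + x 7 * y 3)
    + 1 / 2 * (x 4 * y 5 + x 5 * y 4) + (1 / 4 - 1 / 2 * β) * (x 4 * y 7 + x 7 * y 4)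
    + (1 / 4 + 1 / 2 * γ) * (x 5 * y 7 + x 7 * y 5)
    + (-1 / 4 + ψ - 1 / 4 * γ + 1 / 2 * β - 3 / 4 * α) * (x 6 * y 7 + x 7 * y 6)
    + (1 / 4 - ψ + 1 / 2 * γ) * x 7 * y 7]

/-- The form of the model. -/
noncomputable def formVec (α β γ ψ : ℝ) (x y : Fin 8 → ℝ) : ℝ :=
  x 0 * y 0 + α * (x 0 * y 1 + x 1 * y 0) + γ * (x 0 * y 2 + x 2 * y 0)
  + α * (x 0 * y 3 + x 3 * y 0) + ψ * (x 0 * y 4 + x 4 * y 0) + γ * (x 0 * y 5 + x 5 * y 0)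
  + ψ * (x 0 * y 6 + x 6 * y 0) + (-1 / 2 * ψ + 1 / 2 * β + α * γ) * (x 0 * y 7 + x 7 * y 0)
  + x 1 * y 1 + β * (x 1 * y 2 + x 2 * y 1) + α * (x 1 * y 3 + x 3 * y 1)
  + β * (x 1 * y 4 + x 4 * y 1) + ψ * (x 1 * y 5 + x 5 * y 1)
  + (-1 / 2 * ψ + 1 / 2 * γ + α * β) * (x 1 * y 6 + x 6 * y 1) + ψ * (x 1 * y 7 + x 7 * y 1)
  + x 2 * y 2 + ψ * (x 2 * y 3 + x 3 * y 2) + β * (x 2 * y 4 + x 4 * y 2)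
  + γ * (x 2 * y 5 + x 5 * y 2) + (-1 / 2 * ψ + β * γ + 1 / 2 * α) * (x 2 * y 6 + x 6 * y 2)
  + (-1 / 2 * ψ + β * γ + 1 / 2 * α) * (x 2 * y 7 + x 7 * y 2)
  + (1 / 2 - 1 / 2 * α + α ^ 2) * x 3 * y 3
  + (-1 / 2 * ψ + 1 / 2 * γ + α * β) * (x 3 * y 4 + x 4 * y 3)
  + (-1 / 2 * ψ + 1 / 2 * β + α * γ) * (x 3 * y 5 + x 5 * y 3)
  + (1 / 4 * ψ - 1 / 4 * γ + 1 / 2 * β + α * ψ - 1 / 2 * α * β) * (x 3 * y 6 + x 6 * y 3)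
  + (1 / 4 * ψ + 1 / 2 * γ - 1 / 4 * β + α * ψ - 1 / 2 * α * γ) * (x 3 * y 7 + x 7 * y 3)
  + (1 / 2 - 1 / 2 * β + β ^ 2) * x 4 * y 4
  + (-1 / 2 * ψ + β * γ + 1 / 2 * α) * (x 4 * y 5 + x 5 * y 4)
  + (-1 / 2 * ψ - 1 / 4 * γ - β * ψ + 3 / 2 * β * γ - 1 / 4 * α + 3 / 2 * α * β) * (x 4 * y 6 + x 6
    * y 4)
  + (1 / 4 * ψ + 1 / 2 * γ + β * ψ - 1 / 2 * β * γ - 1 / 4 * α) * (x 4 * y 7 + x 7 * y 4)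
  + (1 / 2 - 1 / 2 * γ + γ ^ 2) * x 5 * y 5
  + (1 / 4 * ψ + γ * ψ + 1 / 2 * β - 1 / 2 * β * γ - 1 / 4 * α) * (x 5 * y 6 + x 6 * y 5)
  + (-1 / 2 * ψ - γ * ψ - 1 / 4 * β + 3 / 2 * β * γ - 1 / 4 * α + 3 / 2 * α * γ) * (x 5 * y 7 + x 7
    * y 5)
  + (1 / 4 + 1 / 4 * ψ + ψ ^ 2 + 1 / 8 * γ - 1 / 4 * β + 1 / 2 * β * ψ - 3 / 4 * β * γ + 1 / 2
    * β ^ 2 + 1 / 8 * α - 3 / 4 * α * β) * x 6 * y 6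
  + (-1 / 8 - 1 / 8 * ψ - 1 / 2 * ψ ^ 2 + 1 / 8 * γ + 1 / 4 * γ * ψ - 1 / 4 * γ ^ 2 + 1 / 8 * β
    + 1 / 4 * β * ψ + 3 / 4 * β * γ - 1 / 4 * β ^ 2 - 1 / 4 * α - 3 / 4 * α * ψ + α * β * γ + 3 / 4
    * α ^ 2) * (x 6 * y 7 + x 7 * y 6)
  + (1 / 4 + 1 / 4 * ψ + ψ ^ 2 - 1 / 4 * γ + 1 / 2 * γ * ψ + 1 / 2 * γ ^ 2 + 1 / 8 * β - 3 / 4 * β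
    * γ + 1 / 8 * α - 3 / 4 * α * γ) * x 7 * y 7

theorem mulVec_comm (α β γ ψ : ℝ) (x y : Fin 8 → ℝ) :
    mulVec α β γ ψ x y = mulVec α β γ ψ y x := by
  ext k
  fin_cases k <;>
    simp only [mulVec, Matrix.cons_val, Fin.zero_eta, Fin.mk_one, Fin.reduceFinMk] <;> ring

theorem mulVec_add (α β γ ψ : ℝ) (x y z : Fin 8 → ℝ) :
    mulVec α β γ ψ x (y + z) = mulVec α β γ ψ x y + mulVec α β γ ψ x z := by
  ext k
  fin_cases k <;>
    simp only [mulVec, Matrix.cons_val, Pi.add_apply, Fin.zero_eta, Fin.mk_one,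
      Fin.reduceFinMk] <;> ring

theorem mulVec_smul (α β γ ψ r : ℝ) (x y : Fin 8 → ℝ) :
    mulVec α β γ ψ x (r • y) = r • mulVec α β γ ψ x y := by
  ext k
  fin_cases k <;>
    simp only [mulVec, Matrix.cons_val, Pi.smul_apply, smul_eq_mul, Fin.zero_eta, Fin.mk_one,
      Fin.reduceFinMk] <;> ring

/-- The decisive polynomial identity of the model: with it, the general theory of idempotents
supplies the eigenspaces and fusion laws of the generators. -/
theorem mulVec_cube (α β γ ψ : ℝ) (x : Fin 8 → ℝ) :
    mulVec α β γ ψ x (mulVec α β γ ψ x x) = formVec α β γ ψ x x • x := by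
  ext k
  fin_cases k <;>
    simp only [mulVec, formVec, Matrix.cons_val, Pi.smul_apply, smul_eq_mul, Fin.zero_eta,
      Fin.mk_one, Fin.reduceFinMk] <;> ring

theorem formVec_symm (α β γ ψ : ℝ) (x y : Fin 8 → ℝ) :
    formVec α β γ ψ x y = formVec α β γ ψ y x := by
  simp only [formVec]
  ring

/-- The eight-dimensional model of the universal algebra. -/
def Model (_ _ _ _ : ℝ) : Type u := ULift.{u} (Fin 8 → ℝ)

namespace Model

variable {α β γ ψ : ℝ}

instance : AddCommGroup (Model.{u} α β γ ψ) := inferInstanceAs (AddCommGroup (ULift (Fin 8 → ℝ)))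

noncomputable instance : Module ℝ (Model.{u} α β γ ψ) :=
  inferInstanceAs (Module ℝ (ULift (Fin 8 → ℝ)))

/-- The element of the model with given coordinates. -/
def mk (x : Fin 8 → ℝ) : Model.{u} α β γ ψ := ULift.up x

/-- The coordinates of an element of the model. -/
def coord (x : Model.{u} α β γ ψ) : Fin 8 → ℝ := ULift.down x

@[ext] theorem ext {x y : Model.{u} α β γ ψ} (h : x.coord = y.coord) : x = y := ULift.ext _ _ h

@[simp] theorem coord_mk (x : Fin 8 → ℝ) : (mk x : Model.{u} α β γ ψ).coord = x := rfl

@[simp] theorem coord_add (x y : Model.{u} α β γ ψ) : (x + y).coord = x.coord + y.coord := rfl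

@[simp] theorem coord_zero : (0 : Model.{u} α β γ ψ).coord = 0 := rfl

@[simp] theorem coord_smul (r : ℝ) (x : Model.{u} α β γ ψ) : (r • x).coord = r • x.coord := rfl

@[simp] theorem coord_sub (x y : Model.{u} α β γ ψ) : (x - y).coord = x.coord - y.coord := rfl

noncomputable instance : Mul (Model.{u} α β γ ψ) :=
  ⟨fun x y => mk (mulVec α β γ ψ x.coord y.coord)⟩

@[simp] theorem coord_mul (x y : Model.{u} α β γ ψ) :
    (x * y).coord = mulVec α β γ ψ x.coord y.coord := rfl

theorem mul_comm' (x y : Model.{u} α β γ ψ) : x * y = y * x :=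
  ext (mulVec_comm _ _ _ _ _ _)

theorem mul_add' (x y z : Model.{u} α β γ ψ) : x * (y + z) = x * y + x * z :=
  ext (mulVec_add _ _ _ _ _ _ _)

theorem mul_smul' (r : ℝ) (x y : Model.{u} α β γ ψ) : x * (r • y) = r • (x * y) :=
  ext (mulVec_smul _ _ _ _ _ _ _)

theorem mul_zero' (x : Model.{u} α β γ ψ) : x * 0 = 0 := by
  simpa using mul_smul' 0 x 0

noncomputable instance : NonUnitalNonAssocCommRing (Model.{u} α β γ ψ) where
  left_distrib := mul_add'
  right_distrib x y z := by rw [mul_comm', mul_add', mul_comm' z x, mul_comm' z y]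
  zero_mul x := by rw [mul_comm', mul_zero']
  mul_zero := mul_zero'
  mul_comm := mul_comm'

instance : SMulCommClass ℝ (Model.{u} α β γ ψ) (Model.{u} α β γ ψ) :=
  ⟨fun r x y => (mul_smul' r x y).symm⟩

instance : IsScalarTower ℝ (Model.{u} α β γ ψ) (Model.{u} α β γ ψ) :=
  ⟨fun r x y => by
    change (r • x) * y = r • (x * y)
    rw [mul_comm', mul_smul', mul_comm' y x]⟩

variable (α β γ ψ) in
/-- The bilinear form of the model. -/
noncomputable def form : LinearMap.BilinForm ℝ (Model.{u} α β γ ψ) :=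
  LinearMap.mk₂ ℝ (fun x y => formVec α β γ ψ x.coord y.coord)
    (fun x y z => by simp [formVec]; ring) (fun r x y => by simp [formVec]; ring)
    (fun x y z => by simp [formVec]; ring) (fun r x y => by simp [formVec]; ring)

theorem form_apply (x y : Model.{u} α β γ ψ) :
    form α β γ ψ x y = formVec α β γ ψ x.coord y.coord := rfl

variable (α β γ ψ) in
/-- The first generator. -/
noncomputable abbrev genA : Model.{u} α β γ ψ := mk ![1, 0, 0, 0, 0, 0, 0, 0]

variable (α β γ ψ) in
/-- The second generator. -/
noncomputable abbrev genB : Model.{u} α β γ ψ := mk ![0, 1, 0, 0, 0, 0, 0, 0]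

variable (α β γ ψ) in
/-- The third generator. -/
noncomputable abbrev genC : Model.{u} α β γ ψ := mk ![0, 0, 1, 0, 0, 0, 0, 0]

theorem isPseudoComposition : IsPseudoComposition (form.{u} α β γ ψ) where
  form_ne_zero h := by
    have h1 := congrArg (fun φ => φ (genA.{u} α β γ ψ) (genA.{u} α β γ ψ)) h
    simp [form_apply, formVec] at h1
  form_symm x y := formVec_symm _ _ _ _ _ _
  cube x := ext (mulVec_cube _ _ _ _ _)

theorem genA_mul (x : Model.{u} α β γ ψ) : genA α β γ ψ * x = mk ![
  x.coord 0 + α * x.coord 3 + γ * x.coord 5 + ψ * x.coord 6 + (-1 / 2 * ψ + 1 / 4 * β) * x.coord 7,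
  1 / 2 * x.coord 3 + 1 / 4 * γ * x.coord 7,
  1 / 2 * x.coord 5 - 3 / 4 * α * x.coord 7,
  x.coord 1 - 1 / 2 * x.coord 3 - 1 / 2 * γ * x.coord 7,
  1 / 2 * x.coord 6 - 1 / 4 * x.coord 7,
  x.coord 2 - 1 / 2 * x.coord 5 + 3 / 2 * α * x.coord 7,
  x.coord 4 - 1 / 2 * x.coord 6 + 1 / 2 * x.coord 7,
  1 / 2 * x.coord 7] := by
  ext k
  fin_cases k <;>
    (simp only [coord_mul, coord_mk, mulVec, Matrix.cons_val, Fin.zero_eta, Fin.mk_one,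
      Fin.reduceFinMk]; ring)

theorem genB_mul (x : Model.{u} α β γ ψ) : genB α β γ ψ * x = mk ![
  1 / 2 * x.coord 3 + 1 / 4 * β * x.coord 6,
  x.coord 1 + α * x.coord 3 + β * x.coord 4 + (-1 / 2 * ψ + 1 / 4 * γ) * x.coord 6 + ψ * x.coord 7,
  1 / 2 * x.coord 4 - 3 / 4 * α * x.coord 6,
  x.coord 0 - 1 / 2 * x.coord 3 - 1 / 2 * β * x.coord 6,
  x.coord 2 - 1 / 2 * x.coord 4 + 3 / 2 * α * x.coord 6,
  -1 / 4 * x.coord 6 + 1 / 2 * x.coord 7,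
  1 / 2 * x.coord 6,
  x.coord 5 + 1 / 2 * x.coord 6 - 1 / 2 * x.coord 7] := by
  ext k
  fin_cases k <;>
    (simp only [coord_mul, coord_mk, mulVec, Matrix.cons_val, Fin.zero_eta, Fin.mk_one,
      Fin.reduceFinMk]; ring)

theorem genC_mul (x : Model.{u} α β γ ψ) : genC α β γ ψ * x = mk ![
  β * x.coord 3 + 1 / 2 * x.coord 5 + 3 / 4 * β * x.coord 6 - 1 / 4 * β * x.coord 7,
  γ * x.coord 3 + 1 / 2 * x.coord 4 - 1 / 4 * γ * x.coord 6 + 3 / 4 * γ * x.coord 7,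
  x.coord 2 + α * x.coord 3 + β * x.coord 4 + γ * x.coord 5 + (-1 / 2 * ψ + 3 / 4 * α) * x.coord 6
    + (-1 / 2 * ψ + 3 / 4 * α) * x.coord 7,
  -1 / 4 * x.coord 6 - 1 / 4 * x.coord 7,
  x.coord 1 - 1 / 2 * x.coord 4 + 3 / 2 * γ * x.coord 6 - 1 / 2 * γ * x.coord 7,
  x.coord 0 - 1 / 2 * x.coord 5 - 1 / 2 * β * x.coord 6 + 3 / 2 * β * x.coord 7,
  -x.coord 3 - 1 / 2 * x.coord 7,
  -x.coord 3 - 1 / 2 * x.coord 6] := by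
  ext k
  fin_cases k <;>
    (simp only [coord_mul, coord_mk, mulVec, Matrix.cons_val, Fin.zero_eta, Fin.mk_one,
      Fin.reduceFinMk]; ring)

theorem form_genA (x : Model.{u} α β γ ψ) : form α β γ ψ (genA α β γ ψ) x =
    x.coord 0 + α * x.coord 1 + γ * x.coord 2 + α * x.coord 3 + ψ * x.coord 4 + γ * x.coord 5
    + ψ * x.coord 6 + (-1 / 2 * ψ + 1 / 2 * β + α * γ) * x.coord 7 := by
  simp [form_apply, formVec]

theorem form_genB (x : Model.{u} α β γ ψ) : form α β γ ψ (genB α β γ ψ) x =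
    α * x.coord 0 + x.coord 1 + β * x.coord 2 + α * x.coord 3 + β * x.coord 4 + ψ * x.coord 5
    + (-1 / 2 * ψ + 1 / 2 * γ + α * β) * x.coord 6 + ψ * x.coord 7 := by
  simp [form_apply, formVec]

theorem form_genC (x : Model.{u} α β γ ψ) : form α β γ ψ (genC α β γ ψ) x =
    γ * x.coord 0 + β * x.coord 1 + x.coord 2 + ψ * x.coord 3 + β * x.coord 4 + γ * x.coord 5
    + (-1 / 2 * ψ + β * γ + 1 / 2 * α) * x.coord 6 + (-1 / 2 * ψ + β * γ + 1 / 2 * α)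
      * x.coord 7 := by
  simp [form_apply, formVec]

theorem mk_ne_zero {x : Fin 8 → ℝ} (i : Fin 8) (h : x i ≠ 0) : (mk x : Model.{u} α β γ ψ) ≠ 0 :=
  fun h0 => h (congrFun (congrArg coord h0) i)

theorem genA_idem : genA.{u} α β γ ψ * genA α β γ ψ = genA α β γ ψ := by
  simp [genA_mul]

theorem genB_idem : genB.{u} α β γ ψ * genB α β γ ψ = genB α β γ ψ := by
  simp [genB_mul]

theorem genC_idem : genC.{u} α β γ ψ * genC α β γ ψ = genC α β γ ψ := by
  simp [genC_mul]

/-- Every element is the expected combination of monomials in the generators. -/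
theorem eq_combination (x : Model.{u} α β γ ψ) : x = x.coord 0 • genA α β γ ψ +
    x.coord 1 • genB α β γ ψ + x.coord 2 • genC α β γ ψ +
    x.coord 3 • (genA α β γ ψ * genB α β γ ψ) + x.coord 4 • (genB α β γ ψ * genC α β γ ψ) +
    x.coord 5 • (genA α β γ ψ * genC α β γ ψ) +
    x.coord 6 • (genA α β γ ψ * (genB α β γ ψ * genC α β γ ψ)) +
    x.coord 7 • (genB α β γ ψ * (genA α β γ ψ * genC α β γ ψ)) := by
  ext k
  fin_cases k <;> simp [genA_mul, genB_mul]

theorem adjoin_eq_top :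
    NonUnitalAlgebra.adjoin ℝ {genA.{u} α β γ ψ, genB α β γ ψ, genC α β γ ψ} = ⊤ := by
  rw [eq_top_iff]
  intro x _
  have ha := NonUnitalAlgebra.subset_adjoin ℝ (s := {genA.{u} α β γ ψ, genB α β γ ψ, genC α β γ ψ})
    (show genA α β γ ψ ∈ _ by simp)
  have hb := NonUnitalAlgebra.subset_adjoin ℝ (s := {genA.{u} α β γ ψ, genB α β γ ψ, genC α β γ ψ})
    (show genB α β γ ψ ∈ _ by simp)
  have hc := NonUnitalAlgebra.subset_adjoin ℝ (s := {genA.{u} α β γ ψ, genB α β γ ψ, genC α β γ ψ})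
    (show genC α β γ ψ ∈ _ by simp)
  rw [eq_combination x]
  exact add_mem (add_mem (add_mem (add_mem (add_mem (add_mem (add_mem (SMulMemClass.smul_mem _ ha)
    (SMulMemClass.smul_mem _ hb)) (SMulMemClass.smul_mem _ hc))
    (SMulMemClass.smul_mem _ (mul_mem ha hb))) (SMulMemClass.smul_mem _ (mul_mem hb hc)))
    (SMulMemClass.smul_mem _ (mul_mem ha hc)))
    (SMulMemClass.smul_mem _ (mul_mem ha (mul_mem hb hc))))
    (SMulMemClass.smul_mem _ (mul_mem hb (mul_mem ha hc)))

variable (α β γ ψ) in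
theorem isThreeGenerated : IsThreeGenerated (form.{u} α β γ ψ) (genA α β γ ψ) (genB α β γ ψ)
    (genC α β γ ψ) α β γ ψ where
  pc := isPseudoComposition
  axis_a := isPseudoComposition.isAxis genA_idem (mk_ne_zero 0 (by simp))
  axis_b := isPseudoComposition.isAxis genB_idem (mk_ne_zero 1 (by simp))
  axis_c := isPseudoComposition.isAxis genC_idem (mk_ne_zero 2 (by simp))
  gen := adjoin_eq_top
  form_ab := by simp [form_genA]
  form_bc := by simp [form_genB]
  form_ac := by simp [form_genA]
  form_b_ac := by simp [form_genB, genA_mul]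

end Model

/-! ### Relations between monomials in three axes. -/

section Relations

variable {A : Type*} [NonUnitalNonAssocCommRing A] [Module ℝ A]
  [IsScalarTower ℝ A A] [SMulCommClass ℝ A A] {φ : LinearMap.BilinForm ℝ A}

namespace IsPseudoComposition

variable {e : A}

/-- The product `e (x (e y))` in terms of shorter monomials. -/
theorem idem_mul_mul_idem (h : IsPseudoComposition φ) (he : e * e = e) (h0 : e ≠ 0) {x y : A}
    {s : ℝ} (hs : φ e (x * y) = s) (hs' : φ x (e * y) = s) :
    e * (x * (e * y)) = (1 / 2 : ℝ) • ((3 * φ e x) • (e * y) - φ e y • (e * x) + φ e y • x -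
      φ e x • y + (φ x y - s) • e + (1 / 2 : ℝ) • (e * (x * y) + x * (e * y) - y * (e * x) -
      x * y)) := by
  have h1 := h.polar e x (e * y)
  have h2 := h.polar e y (e * x)
  have h3 := congrArg (e * ·) (h.polar e x y)
  have h4 : φ y (e * x) = s := by
    rw [← h.form_mul_left he h0, h.form_symm, hs']
  simp only [mul_add, mul_smul_comm, he, h.idem_sq he h0, h.form_idem_mul he h0, h4, hs, hs',
    mul_sub, mul_comm y x, mul_comm (e * y) (e * x), mul_comm x e, mul_comm y e] at h1 h2 h3
  -- With these signs (ex)(ey) and e(y(ex)) cancel, while e(x(ey)) occurs twice.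
  linear_combination (norm := module) (1 / 2 : ℝ) • (h1 - h2 + h3)

end IsPseudoComposition

namespace IsThreeGenerated

variable {a b c : A} {α β γ ψ : ℝ}

/-- Self-adjointness of multiplication by b and by a moves the factors around. Thus ψ is symmetric
in the three axes, which is what makes `swap` and `rotate` possible. -/
theorem form_a_bc (h : IsThreeGenerated φ a b c α β γ ψ) : φ a (b * c) = ψ := by
  rw [← h.pc.form_mul_left h.axis_b.idem h.axis_b.ne_zero, mul_comm b a,
    h.pc.form_mul_left h.axis_a.idem h.axis_a.ne_zero, h.form_b_ac]

/-- Exchanging the first two generators. -/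
theorem swap (h : IsThreeGenerated φ a b c α β γ ψ) : IsThreeGenerated φ b a c α γ β ψ where
  pc := h.pc
  axis_a := h.axis_b
  axis_b := h.axis_a
  axis_c := h.axis_c
  gen := by rw [Set.insert_comm, h.gen]
  form_ab := by rw [h.pc.form_symm, h.form_ab]
  form_bc := h.form_ac
  form_ac := h.form_bc
  form_b_ac := h.form_a_bc

/-- Permuting the generators cyclically. -/
theorem rotate (h : IsThreeGenerated φ a b c α β γ ψ) : IsThreeGenerated φ b c a β γ α ψ where
  pc := h.pc
  axis_a := h.axis_b
  axis_b := h.axis_c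
  axis_c := h.axis_a
  gen := by
    rw [← h.gen]
    congr 1
    ext x
    simp only [Set.mem_insert_iff, Set.mem_singleton_iff]
    tauto
  form_ab := h.form_bc
  form_bc := by rw [h.pc.form_symm, h.form_ac]
  form_ac := by rw [h.pc.form_symm, h.form_ab]
  form_b_ac := by
    rw [mul_comm b a, h.pc.form_symm, h.pc.form_mul_left h.axis_a.idem h.axis_a.ne_zero,
      h.form_b_ac]

theorem mul_ab (h : IsThreeGenerated φ a b c α β γ ψ) :
    a * (a * b) = (1 / 2 : ℝ) • (b - a * b) + α • a := by
  rw [h.pc.idem_sq h.axis_a.idem h.axis_a.ne_zero, h.form_ab]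

theorem mul_ac (h : IsThreeGenerated φ a b c α β γ ψ) :
    a * (a * c) = (1 / 2 : ℝ) • (c - a * c) + γ • a := by
  rw [h.pc.idem_sq h.axis_a.idem h.axis_a.ne_zero, h.form_ac]

theorem mul_a_bc (h : IsThreeGenerated φ a b c α β γ ψ) :
    a * (a * (b * c)) = (1 / 2 : ℝ) • (b * c - a * (b * c)) + ψ • a := by
  rw [h.pc.idem_sq h.axis_a.idem h.axis_a.ne_zero, h.form_a_bc]

/-- The linearized identity at a, b, c eliminates one of the three cubic monomials, leaving eight
spanning elements. -/
theorem c_mul_ab (h : IsThreeGenerated φ a b c α β γ ψ) :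
    c * (a * b) = α • c + β • a + γ • b - a * (b * c) - b * (a * c) := by
  have h1 := h.pc.polar a b c
  rw [h.form_ab, h.form_bc, h.form_ac] at h1
  linear_combination (norm := module) h1

theorem a_mul_b_ac (h : IsThreeGenerated φ a b c α β γ ψ) :
    a * (b * (a * c)) = (β / 4 - ψ / 2) • a + (γ / 4) • b - (3 / 4 * α) • c - (γ / 2) • (a * b) -
      (1 / 4 : ℝ) • (b * c) + (3 / 2 * α) • (a * c) + (1 / 2 : ℝ) • (a * (b * c)) +
      (1 / 2 : ℝ) • (b * (a * c)) := by
  rw [h.pc.idem_mul_mul_idem h.axis_a.idem h.axis_a.ne_zero h.form_a_bc h.form_b_ac, h.form_ab,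
    h.form_ac, h.form_bc, h.c_mul_ab]
  module

theorem form_a_b_ac (h : IsThreeGenerated φ a b c α β γ ψ) :
    φ a (b * (a * c)) = -(1 / 2) * ψ + 1 / 2 * β + α * γ := by
  rw [← h.pc.form_mul_left h.axis_b.idem h.axis_b.ne_zero, mul_comm b a,
    h.pc.form_mul_left h.axis_a.idem h.axis_a.ne_zero, h.mul_ac]
  simp only [map_add, map_sub, map_smul, smul_eq_mul, h.form_bc, h.form_b_ac,
    h.pc.form_symm b a, h.form_ab]
  ring

end IsThreeGenerated

end Relations

/-! ### Evaluation of the model in a three-generated algebra, and universality. -/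

namespace Model

variable {B : Type*} [NonUnitalNonAssocCommRing B] [Module ℝ B]
  [IsScalarTower ℝ B B] [SMulCommClass ℝ B B] {φ : LinearMap.BilinForm ℝ B}
  {α β γ ψ : ℝ} {a b c : B}

variable (α β γ ψ a b c) in
/-- The linear map from the model sending basis monomials to the same monomials in `a, b, c`. -/
noncomputable def evalLin : Model.{u} α β γ ψ →ₗ[ℝ] B where
  toFun x := x.coord 0 • a + x.coord 1 • b + x.coord 2 • c + x.coord 3 • (a * b) +
    x.coord 4 • (b * c) + x.coord 5 • (a * c) + x.coord 6 • (a * (b * c)) +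
    x.coord 7 • (b * (a * c))
  map_add' x y := by simp only [coord_add, Pi.add_apply]; module
  map_smul' r x := by simp only [coord_smul, Pi.smul_apply, smul_eq_mul, RingHom.id_apply]; module

theorem evalLin_apply (x : Model.{u} α β γ ψ) : evalLin α β γ ψ a b c x =
    x.coord 0 • a + x.coord 1 • b + x.coord 2 • c + x.coord 3 • (a * b) +
    x.coord 4 • (b * c) + x.coord 5 • (a * c) + x.coord 6 • (a * (b * c)) +
    x.coord 7 • (b * (a * c)) := rfl

@[simp] theorem evalLin_genA : evalLin.{u} α β γ ψ a b c (genA α β γ ψ) = a := by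
  simp [evalLin_apply]

@[simp] theorem evalLin_genB : evalLin.{u} α β γ ψ a b c (genB α β γ ψ) = b := by
  simp [evalLin_apply]

@[simp] theorem evalLin_genC : evalLin.{u} α β γ ψ a b c (genC α β γ ψ) = c := by
  simp [evalLin_apply]

theorem evalLin_genA_mul (h : IsThreeGenerated φ a b c α β γ ψ) (x : Model.{u} α β γ ψ) :
    evalLin α β γ ψ a b c (genA α β γ ψ * x) = a * evalLin α β γ ψ a b c x := by
  simp only [genA_mul, evalLin_apply, coord_mk, Matrix.cons_val, mul_add, mul_smul_comm,
    h.mul_ab, h.mul_ac, h.mul_a_bc, h.a_mul_b_ac, h.axis_a.idem]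
  module

theorem evalLin_genB_mul (h : IsThreeGenerated φ a b c α β γ ψ) (x : Model.{u} α β γ ψ) :
    evalLin α β γ ψ a b c (genB α β γ ψ * x) = b * evalLin α β γ ψ a b c x := by
  simp only [genB_mul, evalLin_apply, coord_mk, Matrix.cons_val, mul_add, mul_smul_comm,
    mul_comm a b, h.swap.mul_ab, h.swap.mul_ac, h.swap.mul_a_bc, h.swap.a_mul_b_ac, h.axis_b.idem]
  module

/-- The relations come from those for a by permuting the generators, but they then involve c(ab),
which is not a basis monomial and has to be removed by `c_mul_ab`. -/
theorem evalLin_genC_mul (h : IsThreeGenerated φ a b c α β γ ψ) (x : Model.{u} α β γ ψ) :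
    evalLin α β γ ψ a b c (genC α β γ ψ * x) = c * evalLin α β γ ψ a b c x := by
  have h1 := h.rotate.rotate.a_mul_b_ac
  have h2 := h.rotate.swap.a_mul_b_ac
  have h3 := h.rotate.rotate.mul_ab
  have h4 := h.rotate.rotate.mul_ac
  simp only [mul_comm c a, mul_comm c b, mul_comm b a, h.c_mul_ab] at h1 h2 h3 h4
  simp only [genC_mul, evalLin_apply, coord_mk, Matrix.cons_val, mul_add, mul_smul_comm,
    mul_comm c a, mul_comm c b, h.c_mul_ab, h1, h2, h3, h4, h.axis_c.idem]
  module

/-- If `evalLin` preserves the form, it is multiplicative. -/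
theorem evalLin_mul (h : IsThreeGenerated φ a b c α β γ ψ)
    (hφ : ∀ x y : Model.{u} α β γ ψ, φ (evalLin α β γ ψ a b c x) (evalLin α β γ ψ a b c y) =
      form α β γ ψ x y) (x y : Model.{u} α β γ ψ) :
    evalLin α β γ ψ a b c (x * y) = evalLin α β γ ψ a b c x * evalLin α β γ ψ a b c y := by
  have hx : x ∈ NonUnitalAlgebra.adjoin ℝ {genA.{u} α β γ ψ, genB α β γ ψ, genC α β γ ψ} := by
    simp [adjoin_eq_top]
  induction hx using NonUnitalAlgebra.adjoin_induction generalizing y with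
  | mem x hx =>
    rcases hx with rfl | rfl | rfl
    · rw [evalLin_genA_mul h, evalLin_genA]
    · rw [evalLin_genB_mul h, evalLin_genB]
    · rw [evalLin_genC_mul h, evalLin_genC]
  | zero => simp
  | add x z _ _ h1 h2 => simp [add_mul, h1, h2]
  | smul r x _ h1 => simp [smul_mul_assoc, h1]
  | mul x z _ _ h1 h2 =>
    -- The linearized identity rewrites (xz)y through x(zy), z(xy) and values of the form, on both
    -- sides of the map. The induction hypotheses and `hφ` match everything else.
    have h3 := h.pc.polar (evalLin α β γ ψ a b c x) (evalLin α β γ ψ a b c z)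
      (evalLin α β γ ψ a b c y)
    have h4 := congrArg (evalLin α β γ ψ a b c) (isPseudoComposition.polar x z y)
    simp only [map_add, map_smul, h1, h2, mul_comm y] at h4
    simp only [hφ] at h3
    rw [mul_comm _ (evalLin α β γ ψ a b c y), h1]
    linear_combination (norm := module) h4 - h3

theorem form_evalLin_genA (h : IsThreeGenerated φ a b c α β γ ψ) (x : Model.{u} α β γ ψ) :
    φ a (evalLin α β γ ψ a b c x) = form α β γ ψ (genA α β γ ψ) x := by
  have hi := h.pc.form_idem_mul h.axis_a.idem h.axis_a.ne_zero
  simp only [form_genA, evalLin_apply, map_add, map_smul, smul_eq_mul, hi, h.form_ab, h.form_ac,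
    h.form_a_bc, h.form_a_b_ac, h.pc.form_idem h.axis_a.idem h.axis_a.ne_zero]
  ring

theorem form_evalLin_genB (h : IsThreeGenerated φ a b c α β γ ψ) (x : Model.{u} α β γ ψ) :
    φ b (evalLin α β γ ψ a b c x) = form α β γ ψ (genB α β γ ψ) x := by
  have hi := h.pc.form_idem_mul h.axis_b.idem h.axis_b.ne_zero
  simp only [form_genB, evalLin_apply, map_add, map_smul, smul_eq_mul, hi, mul_comm a b,
    h.swap.form_ab, h.form_bc, h.form_b_ac, h.swap.form_a_b_ac,
    h.pc.form_idem h.axis_b.idem h.axis_b.ne_zero]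
  ring

theorem form_evalLin_genC (h : IsThreeGenerated φ a b c α β γ ψ) (x : Model.{u} α β γ ψ) :
    φ c (evalLin α β γ ψ a b c x) = form α β γ ψ (genC α β γ ψ) x := by
  have h1 := h.rotate.rotate.form_a_b_ac
  have h2 := h.rotate.swap.form_a_b_ac
  simp only [mul_comm c a, mul_comm c b] at h1 h2
  simp only [form_genC, evalLin_apply, map_add, map_smul, smul_eq_mul, ← mul_comm c b,
    ← mul_comm c a, h.pc.form_idem_mul h.axis_c.idem h.axis_c.ne_zero]
  simp only [mul_comm c a, mul_comm c b, h.rotate.rotate.form_ab, h.rotate.rotate.form_ac,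
    h.rotate.rotate.form_a_bc, h1, h2,
    h.pc.form_idem h.axis_c.idem h.axis_c.ne_zero]
  ring

/-- The elements u whose pairing with everything is preserved include the generators and, by
self-adjointness, are stable under multiplication by a and by b. The basis avoids left
multiplication by c, so these two suffice. -/
theorem form_evalLin (h : IsThreeGenerated φ a b c α β γ ψ) (x y : Model.{u} α β γ ψ) :
    φ (evalLin α β γ ψ a b c x) (evalLin α β γ ψ a b c y) = form α β γ ψ x y := by
  have ga := isThreeGenerated.{u} α β γ ψ
  have ha : ∀ u : Model.{u} α β γ ψ, (∀ y : Model.{u} α β γ ψ, φ (evalLin α β γ ψ a b c u)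
      (evalLin α β γ ψ a b c y) = form α β γ ψ u y) → ∀ y, φ (evalLin α β γ ψ a b c
      (genA α β γ ψ * u)) (evalLin α β γ ψ a b c y) = form α β γ ψ (genA α β γ ψ * u) y := by
    intro u hu y
    rw [evalLin_genA_mul h, h.pc.form_mul_left h.axis_a.idem h.axis_a.ne_zero,
      ← evalLin_genA_mul h, hu, ga.pc.form_mul_left ga.axis_a.idem ga.axis_a.ne_zero]
  have hb : ∀ u : Model.{u} α β γ ψ, (∀ y : Model.{u} α β γ ψ, φ (evalLin α β γ ψ a b c u)
      (evalLin α β γ ψ a b c y) = form α β γ ψ u y) → ∀ y, φ (evalLin α β γ ψ a b c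
      (genB α β γ ψ * u)) (evalLin α β γ ψ a b c y) = form α β γ ψ (genB α β γ ψ * u) y := by
    intro u hu y
    rw [evalLin_genB_mul h, h.pc.form_mul_left h.axis_b.idem h.axis_b.ne_zero,
      ← evalLin_genB_mul h, hu, ga.pc.form_mul_left ga.axis_b.idem ga.axis_b.ne_zero]
  have a1 : ∀ y : Model.{u} α β γ ψ,
      φ (evalLin α β γ ψ a b c (genA.{u} α β γ ψ)) (evalLin α β γ ψ a b c y) =
      form α β γ ψ (genA α β γ ψ) y := fun y => by rw [evalLin_genA, form_evalLin_genA h]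
  have b1 : ∀ y : Model.{u} α β γ ψ,
      φ (evalLin α β γ ψ a b c (genB.{u} α β γ ψ)) (evalLin α β γ ψ a b c y) =
      form α β γ ψ (genB α β γ ψ) y := fun y => by rw [evalLin_genB, form_evalLin_genB h]
  have c1 : ∀ y : Model.{u} α β γ ψ,
      φ (evalLin α β γ ψ a b c (genC.{u} α β γ ψ)) (evalLin α β γ ψ a b c y) =
      form α β γ ψ (genC α β γ ψ) y := fun y => by rw [evalLin_genC, form_evalLin_genC h]
  rw [eq_combination x]
  simp only [map_add, map_smul, LinearMap.add_apply, LinearMap.smul_apply, a1, b1, c1,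
    ha _ b1, hb _ c1, ha _ c1, ha _ (hb _ c1), hb _ (ha _ c1)]

/-- The homomorphism from the model to an algebra generated by three axes. -/
noncomputable def eval (h : IsThreeGenerated φ a b c α β γ ψ) : Model.{u} α β γ ψ →ₙₐ[ℝ] B where
  toFun := evalLin α β γ ψ a b c
  map_smul' := map_smul _
  map_zero' := map_zero _
  map_add' := map_add _
  map_mul' := evalLin_mul h (form_evalLin h)

theorem eval_genA (h : IsThreeGenerated φ a b c α β γ ψ) :
    eval.{u} h (genA α β γ ψ) = a := evalLin_genA

theorem eval_genB (h : IsThreeGenerated φ a b c α β γ ψ) :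
    eval.{u} h (genB α β γ ψ) = b := evalLin_genB

theorem eval_genC (h : IsThreeGenerated φ a b c α β γ ψ) :
    eval.{u} h (genC α β γ ψ) = c := evalLin_genC

theorem form_eval (h : IsThreeGenerated φ a b c α β γ ψ) (x y : Model.{u} α β γ ψ) :
    φ (eval h x) (eval h y) = form α β γ ψ x y := form_evalLin h x y

theorem eval_surjective (h : IsThreeGenerated φ a b c α β γ ψ) :
    Function.Surjective (eval.{u} h) := by
  intro y
  have hy : y ∈ NonUnitalAlgebra.adjoin ℝ {a, b, c} := by simp [h.gen]
  induction hy using NonUnitalAlgebra.adjoin_induction with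
  | mem x hx =>
    rcases hx with rfl | rfl | rfl
    exacts [⟨_, eval_genA h⟩, ⟨_, eval_genB h⟩, ⟨_, eval_genC h⟩]
  | zero => exact ⟨0, map_zero _⟩
  | add x z _ _ h1 h2 =>
    obtain ⟨x, rfl⟩ := h1
    obtain ⟨z, rfl⟩ := h2
    exact ⟨x + z, map_add _ _ _⟩
  | smul r x _ h1 =>
    obtain ⟨x, rfl⟩ := h1
    exact ⟨r • x, map_smul _ _ _⟩
  | mul x z _ _ h1 h2 =>
    obtain ⟨x, rfl⟩ := h1
    obtain ⟨z, rfl⟩ := h2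
    exact ⟨x * z, map_mul _ _ _⟩

variable (α β γ ψ) in
theorem isUniversal : IsUniversal (form.{u} α β γ ψ) (genA α β γ ψ) (genB α β γ ψ)
    (genC α β γ ψ) α β γ ψ where
  toIsThreeGenerated := isThreeGenerated α β γ ψ
  universal _ _ _ _ _ _ _ _ _ h :=
    ⟨eval h, eval_surjective h, eval_genA h, eval_genB h, eval_genC h⟩

end Model

/-! ### Triples of involutions in A₅. -/

/-- `z` commutes with one of five involutions of the dihedral group `⟨x, y⟩`. -/
def CommutesDihedral {G : Type*} [Mul G] (x y z : G) : Prop :=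
  Commute x z ∨ Commute y z ∨ Commute (x * y * x) z ∨ Commute (y * x * y) z ∨
    Commute (x * (y * x * y) * x) z

instance {G : Type*} [Mul G] [DecidableEq G] (x y z : G) : Decidable (CommutesDihedral x y z) := by
  unfold CommutesDihedral Commute SemiconjBy
  infer_instance

/-- For three elements of `A₅` whose squares are trivial, one commutes with an involution of the
dihedral group generated by the other two. -/
theorem commutesDihedral_alternatingGroup : ∀ x : alternatingGroup (Fin 5), x * x = 1 →
    ∀ y : alternatingGroup (Fin 5), y * y = 1 → ∀ z : alternatingGroup (Fin 5), z * z = 1 →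
    CommutesDihedral x y z ∨ CommutesDihedral y z x ∨ CommutesDihedral z x y := by
  -- The exhaustive check has a short explanation for involutions. If xy has order 5, the five
  -- reflections fix the five different points, so one of them lies in the Klein four-group
  -- containing z. Products of order 1 or 2 commute outright. If all three products have order 3,
  -- any two of the involutions share a transposition, which forces z to have the same fixed point
  -- as a reflection of some pair.
  decide +kernel

/-! ### Automorphisms, and axes determined by their Miyamoto involutions. -/

section Automorphisms

variable {A : Type*} [NonUnitalNonAssocCommRing A] [Module ℝ A]
  [IsScalarTower ℝ A A] [SMulCommClass ℝ A A] {φ : LinearMap.BilinForm ℝ A}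

theorem miyamoto_mul_self {e : A} (he : IsAxis e) : miyamoto he * miyamoto he = 1 :=
  LinearEquiv.ext fun x => miyamotoLin_involutive he x

namespace IsPseudoComposition

/-- Automorphisms preserve the form. -/
theorem form_map (h : IsPseudoComposition φ) {g : A ≃ₗ[ℝ] A}
    (hg : ∀ x y, g (x * y) = g x * g y) (x y : A) : φ (g x) (g y) = φ x y := by
  have key : ∀ z, φ (g z) (g z) = φ z z := by
    intro z
    rcases eq_or_ne z 0 with rfl | hz
    · simp
    have h1 := h.cube (g z)
    rw [← hg, ← hg, h.cube z, map_smul] at h1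
    exact (smul_left_injective ℝ ((map_ne_zero_iff g g.injective).mpr hz) h1).symm
  have h1 := key (x + y)
  simp only [map_add, LinearMap.add_apply, key, h.form_symm (g y), h.form_symm y] at h1
  linarith

theorem isAxis_map (h : IsPseudoComposition φ) {g : A ≃ₗ[ℝ] A}
    (hg : ∀ x y, g (x * y) = g x * g y) {e : A} (he : IsAxis e) : IsAxis (g e) :=
  h.isAxis (by rw [← hg, he.idem]) ((map_ne_zero_iff g g.injective).mpr he.ne_zero)

/-- The formula for τ_e uses only the product and the form, and g preserves both. -/
theorem miyamoto_map (h : IsPseudoComposition φ) {g : A ≃ₗ[ℝ] A}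
    (hg : ∀ x y, g (x * y) = g x * g y) {e : A} (he : IsAxis e) :
    miyamoto (h.isAxis_map hg he) * g = g * miyamoto he := by
  ext x
  simp only [LinearEquiv.mul_apply, h.miyamoto_apply, map_add, map_sub, map_smul, hg,
    h.form_map hg]

/-- If two distinct axes have the same Miyamoto involution, the `-1`-eigenspace of the first meets
the orthogonal complement of the second trivially. -/
theorem eq_zero_of_miyamoto_eq (h : IsPseudoComposition φ) {e y z : A} (he : IsAxis e)
    (hy : IsAxis y) (heq : miyamoto he = miyamoto hy) (hne : e ≠ y) (hz : e * z = -z)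
    (hyz : φ y z = 0) : z = 0 := by
  have h1 := LinearEquiv.congr_fun heq e
  have h2 := LinearEquiv.congr_fun heq y
  have h3 := LinearEquiv.congr_fun heq z
  have hez := h.form_eq_zero_of_neg he.idem he.ne_zero hz
  simp only [h.miyamoto_apply, he.idem, hy.idem, h.form_idem he.idem he.ne_zero,
    h.form_idem hy.idem hy.ne_zero, h.form_symm y e, mul_comm y e, hz, hyz, hez] at h1 h2 h3
  -- The common involution fixes both e and y; combining the two formulas eliminates ey.
  have h4 : (1 + 2 * φ e y) • (e - y) = 0 := by
    linear_combination (norm := module) (3 / 4 : ℝ) • (h1 + h2)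
  have h5 : φ e y = -(1 / 2) := by
    linarith [(smul_eq_zero.mp h4).resolve_right (sub_ne_zero.mpr hne)]
  rw [h5] at h1
  have h6 : e * y = -e - y := by linear_combination (norm := module) (3 / 4 : ℝ) • h1
  have h7 : y * z = -z := by linear_combination (norm := module) (3 / 4 : ℝ) • h3
  -- For s = e + y one now has s² = −s, φ(s, s) = 1, φ(s, z) = 0 and sz = −2z, so the identity reads
  -- 10z = z.
  have h8 := h.polar_two (e + y) z
  simp only [add_mul, mul_add, hz, h7, map_add, LinearMap.add_apply, hez, hyz, he.idem, hy.idem,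
    h6, h.form_idem he.idem he.ne_zero, h.form_idem hy.idem hy.ne_zero, h.form_symm y e, h5,
    mul_comm y e, mul_comm z e, mul_comm z y, mul_neg, mul_sub] at h8
  linear_combination (norm := module) (1 / 9 : ℝ) • h8

end IsPseudoComposition

/-- Linear independence of seven of the monomials in `a, b, c`. -/
def MonomialIndep (a b c : A) : Prop :=
  ∀ l₁ l₂ l₃ l₄ l₅ l₆ l₇ : ℝ, l₁ • a + l₂ • b + l₃ • c + l₄ • (a * b) + l₅ • (a * c) +
    l₆ • (b * c) + l₇ • (c * (a * b)) = 0 →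
    l₁ = 0 ∧ l₂ = 0 ∧ l₃ = 0 ∧ l₄ = 0 ∧ l₅ = 0 ∧ l₆ = 0 ∧ l₇ = 0

namespace IsThreeGenerated

variable {a b c : A} {α β γ ψ : ℝ}

/-- An axis with the same Miyamoto involution as `c` is equal to `c`. -/
theorem eq_of_miyamoto_eq (h : IsThreeGenerated φ a b c α β γ ψ) (hi : MonomialIndep a b c) {y : A}
    (hy : IsAxis y) (heq : miyamoto h.axis_c = miyamoto hy) : c = y := by
  by_contra hne
  have hc := h.axis_c.idem
  have h0 := h.axis_c.ne_zero
  -- The vectors u and v span a plane in the (−1)-eigenspace of c, and a plane always meets the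
  -- orthogonal complement of y.
  set u := a - (2 : ℝ) • (c * a) + φ c a • c with hu
  set v := b - (2 : ℝ) • (c * b) + φ c b • c with hv
  have hu' : c * u = -u := h.pc.neg_part hc h0 a
  have hv' : c * v = -v := h.pc.neg_part hc h0 b
  have key : ∀ p q : ℝ, p • u + q • v = 0 → p = 0 ∧ q = 0 := by
    intro p q hpq
    have h1 := hi p q (p * φ c a + q * φ c b) 0 (-2 * p) (-2 * q) 0 (by
      rw [hu, hv, mul_comm c a, mul_comm c b] at hpq
      linear_combination (norm := module) hpq)
    exact ⟨h1.1, h1.2.1⟩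
  -- This combination of u and v is orthogonal to y by construction. Its vanishing forces φ(y, u) =
  -- 0, and then u itself would have to vanish.
  have h1 := h.pc.eq_zero_of_miyamoto_eq h.axis_c hy heq hne
    (z := φ y v • u + (-φ y u) • v)
    (by rw [mul_add, mul_smul_comm, mul_smul_comm, hu', hv']; module)
    (by simp only [map_add, map_smul, smul_eq_mul]; ring)
  have h2 := key _ _ h1
  have h3 := h.pc.eq_zero_of_miyamoto_eq h.axis_c hy heq hne hu' (by linarith)
  have h4 := key 1 0 (by simp [h3])
  simp at h4

/-- No Miyamoto involution of an axis in the span of `a, b, ab` commutes with that of `c`. -/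
theorem not_commute_miyamoto (h : IsThreeGenerated φ a b c α β γ ψ) (hi : MonomialIndep a b c)
    {e : A} (he : IsAxis e) (hes : e ∈ Submodule.span ℝ {a, b, a * b}) :
    ¬ Commute (miyamoto he) (miyamoto h.axis_c) := by
  intro hcomm
  have hmul := miyamoto_mul he
  have hy := h.pc.isAxis_map hmul h.axis_c
  -- Conjugating τ_c by τ_e gives the involution of τ_e c; as the two commute, it is again τ_c.
  have h1 : miyamoto h.axis_c = miyamoto hy :=
    mul_right_cancel (hcomm.eq.symm.trans (h.pc.miyamoto_map hmul h.axis_c).symm)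
  have h2 := h.eq_of_miyamoto_eq hi hy h1
  rw [h.pc.miyamoto_apply] at h2
  obtain ⟨l, m, k, hlmk⟩ := Submodule.mem_span_triple.mp hes
  -- These are the coefficients of τ_e c − c. The product ec contributes only to ac, bc and c(ab),
  -- so c keeps the coefficient −1/3 − 1 = −4/3.
  have h3 := hi (8 / 3 * φ e c * l) (8 / 3 * φ e c * m) (-(4 / 3)) (8 / 3 * φ e c * k)
    (-(4 / 3) * l) (-(4 / 3) * m) (-(4 / 3) * k) (by
      have h4 : e * c = l • (a * c) + m • (b * c) + k • (c * (a * b)) := by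
        rw [← hlmk, add_mul, add_mul, smul_mul_assoc, smul_mul_assoc, smul_mul_assoc,
          mul_comm (a * b) c]
      rw [h4] at h2
      linear_combination (norm := module) (8 / 3 * φ e c) • hlmk - h2)
  linarith [h3.2.2.1]

/-- The Miyamoto involution of `c` commutes with no conjugate of that of `a` or `b` in the group the
latter two generate. -/
theorem not_commutesDihedral (h : IsThreeGenerated φ a b c α β γ ψ) (hi : MonomialIndep a b c) :
    ¬ CommutesDihedral (miyamoto h.axis_a) (miyamoto h.axis_b) (miyamoto h.axis_c) := by
  set S := Submodule.span ℝ {a, b, a * b} with hS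
  have ha : a ∈ S := Submodule.subset_span (by simp)
  have hb : b ∈ S := Submodule.subset_span (by simp)
  have hab : a * b ∈ S := Submodule.subset_span (by simp)
  -- Conjugation by τ_d replaces the axis e by τ_d e, which stays in S as soon as S contains d and
  -- is stable under multiplication by d.
  have conj : ∀ {d : A} (hd : IsAxis d), d ∈ S → (∀ x ∈ S, d * x ∈ S) →
      ∀ t : A ≃ₗ[ℝ] A, (∃ (e : A) (he : IsAxis e), e ∈ S ∧ t = miyamoto he) →
      ∃ (e : A) (he : IsAxis e), e ∈ S ∧ miyamoto hd * t * miyamoto hd = miyamoto he := by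
    rintro d hd hdS hmul _ ⟨e, he, heS, rfl⟩
    refine ⟨_, h.pc.isAxis_map (miyamoto_mul hd) he, ?_, ?_⟩
    · rw [h.pc.miyamoto_apply]
      exact add_mem (sub_mem (S.smul_mem _ heS) (S.smul_mem _ (hmul _ heS))) (S.smul_mem _ hdS)
    · rw [← h.pc.miyamoto_map (miyamoto_mul hd) he, mul_assoc, miyamoto_mul_self, mul_one]
  have hma : ∀ x ∈ S, a * x ∈ S := by
    intro x hx
    obtain ⟨l, m, k, rfl⟩ := Submodule.mem_span_triple.mp hx
    simp only [mul_add, mul_smul_comm, h.axis_a.idem, h.mul_ab]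
    exact add_mem (add_mem (S.smul_mem _ ha) (S.smul_mem _ hab)) (S.smul_mem _
      (add_mem (S.smul_mem _ (sub_mem hb hab)) (S.smul_mem _ ha)))
  have hmb : ∀ x ∈ S, b * x ∈ S := by
    intro x hx
    obtain ⟨l, m, k, rfl⟩ := Submodule.mem_span_triple.mp hx
    simp only [mul_add, mul_smul_comm, h.axis_b.idem, mul_comm a b, h.swap.mul_ab]
    rw [mul_comm b a]
    exact add_mem (add_mem (S.smul_mem _ hab) (S.smul_mem _ hb)) (S.smul_mem _
      (add_mem (S.smul_mem _ (sub_mem ha hab)) (S.smul_mem _ hb)))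
  have conja := conj h.axis_a ha hma
  have conjb := conj h.axis_b hb hmb
  have ga : ∃ (e : A) (he : IsAxis e), e ∈ S ∧ miyamoto h.axis_a = miyamoto he :=
    ⟨a, h.axis_a, ha, rfl⟩
  have gb : ∃ (e : A) (he : IsAxis e), e ∈ S ∧ miyamoto h.axis_b = miyamoto he :=
    ⟨b, h.axis_b, hb, rfl⟩
  have main : ∀ t : A ≃ₗ[ℝ] A, (∃ (e : A) (he : IsAxis e), e ∈ S ∧ t = miyamoto he) →
      ¬ Commute t (miyamoto h.axis_c) := by
    rintro _ ⟨e, he, heS, rfl⟩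
    exact h.not_commute_miyamoto hi he heS
  rintro (h1 | h1 | h1 | h1 | h1)
  exacts [main _ ga h1, main _ gb h1, main _ (conja _ gb) h1, main _ (conjb _ ga) h1,
    main _ (conja _ (conjb _ ga)) h1]

end IsThreeGenerated

end Automorphisms

/-! ### The group is never A₅. -/

section Alternating

variable {A : Type u} [NonUnitalNonAssocCommRing A] [Module ℝ A]
  [IsScalarTower ℝ A A] [SMulCommClass ℝ A A] {φ : LinearMap.BilinForm ℝ A}
  {a b c : A} {α β γ ψ : ℝ}

theorem MonomialIndep.of_map {B : Type*} [NonUnitalNonAssocCommRing B] [Module ℝ B]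
    (f : A →ₙₐ[ℝ] B) (h : MonomialIndep (f a) (f b) (f c)) : MonomialIndep a b c := by
  intro l₁ l₂ l₃ l₄ l₅ l₆ l₇ h0
  refine h l₁ l₂ l₃ l₄ l₅ l₆ l₇ ?_
  simpa using congrArg f h0

namespace Model

theorem monomialIndep_abc :
    MonomialIndep (genA.{u} α β γ ψ) (genB α β γ ψ) (genC α β γ ψ) := by
  intro l₁ l₂ l₃ l₄ l₅ l₆ l₇ h0
  have h1 := fun i => congrFun (congrArg coord h0) i
  simp [genA_mul, genB_mul, genC_mul, Fin.forall_fin_succ] at h1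
  obtain ⟨h1, h2, h3, h4, h5, h6, rfl, -⟩ := h1
  refine ⟨?_, ?_, ?_, ?_, ?_, ?_, ?_⟩ <;> linarith

theorem monomialIndep_bca :
    MonomialIndep (genB.{u} α β γ ψ) (genC α β γ ψ) (genA α β γ ψ) := by
  intro l₁ l₂ l₃ l₄ l₅ l₆ l₇ h0
  have h1 := fun i => congrFun (congrArg coord h0) i
  simp [genA_mul, genB_mul, genC_mul, Fin.forall_fin_succ] at h1
  obtain ⟨h1, h2, h3, h4, h5, h6, rfl, -⟩ := h1
  refine ⟨?_, ?_, ?_, ?_, ?_, ?_, ?_⟩ <;> linarith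

theorem monomialIndep_cab :
    MonomialIndep (genC.{u} α β γ ψ) (genA α β γ ψ) (genB α β γ ψ) := by
  intro l₁ l₂ l₃ l₄ l₅ l₆ l₇ h0
  have h1 := fun i => congrFun (congrArg coord h0) i
  simp [genA_mul, genB_mul, genC_mul, Fin.forall_fin_succ] at h1
  obtain ⟨h1, h2, h3, h4, h5, h6, rfl, -⟩ := h1
  refine ⟨?_, ?_, ?_, ?_, ?_, ?_, ?_⟩ <;> linarith

end Model

/-- Universality enters only through a homomorphism to the model, along which independence of the
monomials is pulled back. All three cyclic orders are needed because the lemma on A₅ does not tell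
which element commutes. -/
theorem IsUniversal.not_alternating (h : IsUniversal φ a b c α β γ ψ) :
    ¬ Nonempty (tripleGroup h.axis_a h.axis_b h.axis_c ≃* alternatingGroup (Fin 5)) := by
  rintro ⟨f⟩
  obtain ⟨g, -, ha, hb, hc⟩ := h.universal _ _ _ _ _ (Model.isThreeGenerated α β γ ψ)
  have h3 := h.toIsThreeGenerated
  have i1 : MonomialIndep a b c := .of_map g (by rw [ha, hb, hc]; exact Model.monomialIndep_abc)
  have i2 : MonomialIndep b c a := .of_map g (by rw [ha, hb, hc]; exact Model.monomialIndep_bca)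
  have i3 : MonomialIndep c a b := .of_map g (by rw [ha, hb, hc]; exact Model.monomialIndep_cab)
  set G := tripleGroup h.axis_a h.axis_b h.axis_c with hG
  let x : G := ⟨miyamoto h.axis_a, Subgroup.subset_closure (by simp)⟩
  let y : G := ⟨miyamoto h.axis_b, Subgroup.subset_closure (by simp)⟩
  let z : G := ⟨miyamoto h.axis_c, Subgroup.subset_closure (by simp)⟩
  have inv : ∀ {w : G}, w * w = 1 → f w * f w = 1 := fun hw => by rw [← map_mul, hw, map_one]
  have hx : x * x = 1 := Subtype.ext (miyamoto_mul_self _)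
  have hy : y * y = 1 := Subtype.ext (miyamoto_mul_self _)
  have hz : z * z = 1 := Subtype.ext (miyamoto_mul_self _)
  have back : ∀ {p q r : G}, CommutesDihedral (f p) (f q) (f r) →
      CommutesDihedral (p : A ≃ₗ[ℝ] A) q r := by
    intro p q r hpqr
    have key : ∀ {s t : G}, Commute (f s) (f t) → Commute (s : A ≃ₗ[ℝ] A) t := fun {s t} hst =>
      congrArg Subtype.val (f.injective (by simpa only [map_mul] using hst.eq) : s * t = t * s)
    simp only [CommutesDihedral, ← map_mul] at hpqr
    exact hpqr.imp key (Or.imp key (Or.imp key (Or.imp key key)))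
  rcases commutesDihedral_alternatingGroup (f x) (inv hx) (f y) (inv hy) (f z) (inv hz) with
    h1 | h1 | h1
  · exact h3.not_commutesDihedral i1 (back h1)
  · exact h3.rotate.not_commutesDihedral i2 (back h1)
  · exact h3.rotate.rotate.not_commutesDihedral i3 (back h1)

end Alternating

/-! ### Comparing two groups through a common permutation action. -/

section Closures

/-- If group elements `t k` permute `n` points in the way the permutations `s k` permute indices,
and only the identity of the group they generate fixes all of the points, then this group is
isomorphic to the one generated by the `s k`. -/
theorem nonempty_closure_mulEquiv {ι G X : Type*} [Group G] {n : ℕ} (act : G →* Equiv.Perm X)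
    {p : Fin n → X} (hp : Function.Injective p) (t : ι → G) (s : ι → Equiv.Perm (Fin n))
    (hts : ∀ k i, act (t k) (p i) = p (s k i))
    (hfaith : ∀ g ∈ Subgroup.closure (Set.range t), (∀ i, act g (p i) = p i) → g = 1) :
    Nonempty (Subgroup.closure (Set.range t) ≃* Subgroup.closure (Set.range s)) := by
  -- H will be the graph of the isomorphism. Its projection to G is injective because the points are
  -- distinct, and its projection to the permutations because of `hfaith`.
  let H : Subgroup (G × Equiv.Perm (Fin n)) := Subgroup.closure (Set.range fun k => (t k, s k))
  have hH : ∀ x ∈ H, ∀ i, act x.1 (p i) = p (x.2 i) := by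
    intro x hx
    induction hx using Subgroup.closure_induction with
    | mem x hx =>
      obtain ⟨k, rfl⟩ := hx
      exact hts k
    | one => simp
    | mul x y _ _ h1 h2 =>
      intro i
      simp [h1, h2]
    | inv x _ h1 =>
      intro i
      have h2 := h1 (x.2⁻¹ i)
      rw [show x.2 (x.2⁻¹ i) = i from x.2.apply_symm_apply i] at h2
      rw [Prod.fst_inv, Prod.snd_inv, map_inv, Equiv.Perm.inv_eq_iff_eq, h2]
  let f := (MonoidHom.fst G (Equiv.Perm (Fin n))).comp H.subtype
  let g := (MonoidHom.snd G (Equiv.Perm (Fin n))).comp H.subtype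
  have hf : f.range = Subgroup.closure (Set.range t) := by
    rw [MonoidHom.range_comp, Subgroup.range_subtype, MonoidHom.map_closure, ← Set.range_comp]
    rfl
  have hg : g.range = Subgroup.closure (Set.range s) := by
    rw [MonoidHom.range_comp, Subgroup.range_subtype, MonoidHom.map_closure, ← Set.range_comp]
    rfl
  have hfi : Function.Injective f := by
    rw [injective_iff_map_eq_one]
    rintro ⟨⟨x, σ⟩, hx⟩ (rfl : x = 1)
    have h1 : σ = 1 := Equiv.ext fun i => hp (by simpa using (hH _ hx i).symm)
    subst h1
    rfl
  have hgi : Function.Injective g := by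
    rw [injective_iff_map_eq_one]
    rintro ⟨⟨x, σ⟩, hx⟩ (rfl : σ = 1)
    have hx' : x ∈ Subgroup.closure (Set.range t) := hf ▸ ⟨⟨(x, 1), hx⟩, rfl⟩
    have h1 : x = 1 := hfaith x hx' fun i => by simpa using hH _ hx i
    subst h1
    rfl
  exact ⟨(MulEquiv.subgroupCongr hf.symm).trans ((MonoidHom.ofInjective hfi).symm.trans
    ((MonoidHom.ofInjective hgi).trans (MulEquiv.subgroupCongr hg)))⟩

end Closures

/-! ### The 21 axes permuted at the special parameters. -/

/-- Three involutions of `21` points generating a group isomorphic to `PSL(2, 7)`. -/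
def involFun : Fin 3 → Fin 21 → Fin 21 :=
  ![![0, 5, 7, 3, 4, 1, 12, 2, 14, 15, 16, 13, 6, 11, 8, 9, 10, 20, 18, 19, 17],
    ![3, 1, 8, 0, 10, 5, 6, 13, 2, 14, 4, 15, 17, 7, 9, 11, 19, 12, 18, 16, 20],
    ![4, 6, 2, 9, 0, 11, 1, 7, 8, 3, 12, 5, 10, 16, 17, 18, 13, 14, 15, 19, 20]]

theorem involFun_involutive (k : Fin 3) : Function.Involutive (involFun k) := by
  revert k
  unfold Function.Involutive
  decide

/-- The permutations given by `involFun`. -/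
def invol (k : Fin 3) : Equiv.Perm (Fin 21) := (involFun_involutive k).toPerm

section Axes

/-- Nine times the coordinates of the `21` axes. -/
def axisVec : Fin 21 → Fin 8 → ℤ :=
  ![![9, 0, 0, 0, 0, 0, 0, 0], ![0, 9, 0, 0, 0, 0, 0, 0], ![0, 0, 9, 0, 0, 0, 0, 0],
    ![-3, 6, 0, -12, 0, 0, 0, 0], ![-3, 0, 6, 0, 0, -12, 0, 0], ![6, -3, 0, -12, 0, 0, 0, 0],
    ![0, -3, 6, 0, -12, 0, 0, 0], ![6, 0, -3, 0, 0, -12, 0, 0], ![0, 6, -3, 0, -12, 0, 0, 0],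
    ![5, 2, 1, 4, -8, 4, -16, -16], ![1, -3, -2, 4, -8, 4, 0, 16],
    ![2, 5, 1, 4, 4, -8, -16, -16], ![-3, 1, -2, 4, 4, -8, 16, 0], ![-2, -3, 1, -8, 4, 4, 0, 16],
    ![-3, -2, 1, -8, 4, 4, 16, 0], ![-2, -2, -7, -4, 8, 8, 16, 16],
    ![2, -3, 2, 8, 8, -4, 0, -16], ![-3, 2, 2, 8, -4, 8, -16, 0], ![-6, -6, 0, 12, 0, 0, 0, 0],
    ![-6, 0, -6, 0, 0, 12, 0, 0], ![0, -6, -6, 0, 12, 0, 0, 0]]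

/-- The matrices of `48 τ_a`, `48 τ_b`, `48 τ_c` for the parameters `1/4, 1/4, 1/4, 5/32`. -/
def reflVec {K : Type*} [CommRing K] (k : Fin 3) (x : Fin 8 → K) : Fin 8 → K :=
  match k with
  | 0 => ![
  48 * x 0 + 32 * x 1 + 32 * x 2 + 16 * x 3 + 20 * x 4 + 16 * x 5 + 10 * x 6 + 15 * x 7,
  -16 * x 1 - 32 * x 3 - 4 * x 7,
  -16 * x 2 - 32 * x 5 + 12 * x 7,
  -64 * x 1 + 16 * x 3 + 8 * x 7,
  -16 * x 4 - 32 * x 6 + 16 * x 7,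
  -64 * x 2 + 16 * x 5 - 24 * x 7,
  -64 * x 4 + 16 * x 6 - 32 * x 7,
  -48 * x 7]
  | 1 => ![
  -16 * x 0 - 32 * x 3 - 4 * x 6,
  32 * x 0 + 48 * x 1 + 32 * x 2 + 16 * x 3 + 16 * x 4 + 20 * x 5 + 15 * x 6 + 10 * x 7,
  -16 * x 2 - 32 * x 4 + 12 * x 6,
  -64 * x 0 + 16 * x 3 + 8 * x 6,
  -64 * x 2 + 16 * x 4 - 24 * x 6,
  -16 * x 5 + 16 * x 6 - 32 * x 7,
  -48 * x 6,
  -64 * x 5 - 32 * x 6 + 16 * x 7]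
  | 2 => ![
  -16 * x 0 - 16 * x 3 - 32 * x 5 - 12 * x 6 + 4 * x 7,
  -16 * x 1 - 16 * x 3 - 32 * x 4 + 4 * x 6 - 12 * x 7,
  32 * x 0 + 32 * x 1 + 48 * x 2 + 4 * x 3 + 16 * x 4 + 16 * x 5 + 7 * x 6 + 7 * x 7,
  -16 * x 3 + 16 * x 6 + 16 * x 7,
  -64 * x 1 + 16 * x 4 - 24 * x 6 + 8 * x 7,
  -64 * x 0 + 16 * x 5 + 8 * x 6 - 24 * x 7,
  64 * x 3 - 16 * x 6 + 32 * x 7,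
  64 * x 3 + 32 * x 6 - 16 * x 7]

/-- With denominators cleared this is a finite computation over ℤ; `reflVec` is generic in the ring
so that the result can be cast to ℝ. -/
theorem reflVec_axisVec (k : Fin 3) (i : Fin 21) (j : Fin 8) :
    reflVec k (axisVec i) j = 48 * axisVec (involFun k i) j := by
  revert k i j
  decide +kernel

theorem axisVec_injective (i j : Fin 21) (h : axisVec i = axisVec j) : i = j := by
  revert i j
  decide +kernel

theorem reflVec_intCast (k : Fin 3) (x : Fin 8 → ℤ) (j : Fin 8) :
    reflVec k (fun j => (x j : ℝ)) j = (reflVec k x j : ℤ) := by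
  fin_cases k <;> fin_cases j <;> simp [reflVec]

namespace Model

/-- The model for the parameters `1/4, 1/4, 1/4, 5/32`. -/
abbrev Klein : Type u := Model.{u} (1 / 4) (1 / 4) (1 / 4) (5 / 32)

/-- The axis with index `i`, scaled by nine. -/
noncomputable def axis (i : Fin 21) : Klein.{u} := mk fun j => (axisVec i j : ℝ)

theorem axis_injective : Function.Injective axis.{u} := by
  intro i j h
  refine axisVec_injective i j (funext fun k => ?_)
  have h1 : (axisVec i k : ℝ) = axisVec j k := congrFun (congrArg coord h) k
  exact_mod_cast h1

theorem smul_eq_axis {x : Klein.{u}} {k : Fin 3} {i : Fin 21}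
    (h : (48 : ℝ) • x = mk (reflVec k (axis.{u} i).coord)) : x = axis (involFun k i) := by
  refine smul_right_injective _ (by norm_num : (48 : ℝ) ≠ 0) ?_
  simp only [h]
  ext j
  simp only [axis, coord_mk, reflVec_intCast, reflVec_axisVec, coord_smul, Pi.smul_apply,
    smul_eq_mul]
  push_cast
  rfl

theorem miyamoto_genA_axis (i : Fin 21) :
    miyamoto (isThreeGenerated.{u} (1 / 4) (1 / 4) (1 / 4) (5 / 32)).axis_a (axis i) =
      axis (involFun 0 i) := by
  refine smul_eq_axis ?_
  rw [isPseudoComposition.miyamoto_apply, genA_mul, form_genA]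
  ext j
  fin_cases j <;>
    (simp only [reflVec, coord_smul, coord_add, coord_sub, coord_mk, Pi.smul_apply, Pi.add_apply,
      Pi.sub_apply, smul_eq_mul, Matrix.cons_val, Fin.zero_eta, Fin.mk_one, Fin.reduceFinMk]; ring)

theorem miyamoto_genB_axis (i : Fin 21) :
    miyamoto (isThreeGenerated.{u} (1 / 4) (1 / 4) (1 / 4) (5 / 32)).axis_b (axis i) =
      axis (involFun 1 i) := by
  refine smul_eq_axis ?_
  rw [isPseudoComposition.miyamoto_apply, genB_mul, form_genB]
  ext j
  fin_cases j <;>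
    (simp only [reflVec, coord_smul, coord_add, coord_sub, coord_mk, Pi.smul_apply, Pi.add_apply,
      Pi.sub_apply, smul_eq_mul, Matrix.cons_val, Fin.zero_eta, Fin.mk_one, Fin.reduceFinMk]; ring)

theorem miyamoto_genC_axis (i : Fin 21) :
    miyamoto (isThreeGenerated.{u} (1 / 4) (1 / 4) (1 / 4) (5 / 32)).axis_c (axis i) =
      axis (involFun 2 i) := by
  refine smul_eq_axis ?_
  rw [isPseudoComposition.miyamoto_apply, genC_mul, form_genC]
  ext j
  fin_cases j <;>
    (simp only [reflVec, coord_smul, coord_add, coord_sub, coord_mk, Pi.smul_apply, Pi.add_apply,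
      Pi.sub_apply, smul_eq_mul, Matrix.cons_val, Fin.zero_eta, Fin.mk_one, Fin.reduceFinMk]; ring)

end Model

end Axes

/-! ### PSL(2,7) acting by conjugation on its 21 involutions. -/

section SpecialLinear

open Matrix

/-- The upper left, upper right and lower left entries of representatives of the involutions of
`PSL(2, 7)`. -/
def involEntries : Fin 21 → ZMod 7 × ZMod 7 × ZMod 7 :=
  ![(0, 1, 6), (1, 1, 5), (1, 2, 6), (3, 2, 2), (3, 5, 5), (1, 5, 1), (2, 5, 6), (1, 6, 2),
    (2, 1, 2), (3, 3, 6), (3, 1, 4), (0, 3, 2), (2, 6, 5), (0, 2, 3), (2, 2, 1), (3, 6, 3),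
    (3, 4, 1), (1, 4, 3), (2, 4, 4), (2, 3, 3), (1, 3, 4)]

theorem involEntries_det (i : Fin 21) : (involEntries i).1 * -(involEntries i).1 -
    (involEntries i).2.1 * (involEntries i).2.2 = 1 := by
  revert i
  decide

/-- Representatives in `SL(2, 7)` of the involutions of `PSL(2, 7)`. -/
def involMat (i : Fin 21) : SpecialLinearGroup (Fin 2) (ZMod 7) :=
  ⟨!![(involEntries i).1, (involEntries i).2.1; (involEntries i).2.2, -(involEntries i).1],
    (det_fin_two_of _ _ _ _).trans (involEntries_det i)⟩

/-- The index of the `k`-th generator. -/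
def genIndex : Fin 3 → Fin 21 := ![0, 1, 2]

/-- Conjugation by a generator acts on the involutions exactly as `involFun` acts on indices.
Inverses are avoided to keep the check decidable by evaluation, and the sign is invisible in PSL. -/
theorem involMat_conj (k : Fin 3) (i : Fin 21) :
    involMat (genIndex k) * involMat i = involMat (involFun k i) * involMat (genIndex k) ∨
    involMat (genIndex k) * involMat i = -(involMat (involFun k i) * involMat (genIndex k)) := by
  revert k i
  decide +kernel

theorem involMat_injective (i j : Fin 21) (h : involMat i = involMat j ∨
    involMat i = -involMat j) : i = j := by
  revert i j
  decide +kernel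

/-- Only the three generators need testing, and this yields faithfulness of the conjugation action.
-/
theorem eq_one_or_of_commute (p q r s : ZMod 7) (hdet : p * s - q * r = 1)
    (h : ∀ k, !![p, q; r, s] * (involMat (genIndex k)).1 =
      (involMat (genIndex k)).1 * !![p, q; r, s] ∨ !![p, q; r, s] * (involMat (genIndex k)).1 =
      -((involMat (genIndex k)).1 * !![p, q; r, s])) :
    !![p, q; r, s] = 1 ∨ !![p, q; r, s] = -1 := by
  revert p q r s
  decide +kernel

/-- Up to sign, the two products of the generators are a non-trivial upper and a non-trivial lower
transvection. Each has order 7, so its powers give the whole root subgroup. -/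
theorem transvection_eq_pow (b : ZMod 7) (i j : Fin 2) (hij : i ≠ j) : ∃ n : Fin 7,
    SpecialLinearGroup.transvection hij b = (involMat 0 * involMat 1 * involMat 2) ^ n.1 ∨
    SpecialLinearGroup.transvection hij b = -(involMat 0 * involMat 1 * involMat 2) ^ n.1 ∨
    SpecialLinearGroup.transvection hij b = (involMat 0 * involMat 2 * involMat 1) ^ n.1 ∨
    SpecialLinearGroup.transvection hij b = -(involMat 0 * involMat 2 * involMat 1) ^ n.1 := by
  revert b i j
  decide +kernel

/-- The projection from `SL(2, 7)` to `PSL(2, 7)`. -/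
def toPSL : SpecialLinearGroup (Fin 2) (ZMod 7) →* ProjectiveSpecialLinearGroup (Fin 2) (ZMod 7) :=
  QuotientGroup.mk' _

theorem toPSL_surjective : Function.Surjective toPSL := QuotientGroup.mk'_surjective _

theorem toPSL_neg (N : SpecialLinearGroup (Fin 2) (ZMod 7)) : toPSL (-N) = toPSL N := by
  refine QuotientGroup.eq.mpr (Subgroup.mem_center_iff.mpr fun g => ?_)
  rw [show (-N)⁻¹ * N = -1 by rw [inv_mul_eq_iff_eq_mul]; simp]
  simp

theorem eq_or_of_toPSL_eq {N N' : SpecialLinearGroup (Fin 2) (ZMod 7)} (h : toPSL N = toPSL N') :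
    N = N' ∨ N = -N' := by
  have h' : (N : ProjectiveSpecialLinearGroup (Fin 2) (ZMod 7)) = N' := h
  obtain ⟨r, hr, hrN⟩ := Matrix.SpecialLinearGroup.mem_center_iff.mp (QuotientGroup.eq.mp h')
  have key : ∀ r : ZMod 7, r ^ 2 = 1 → r = 1 ∨ r = -1 := by decide
  rcases key r (by simpa using hr) with rfl | rfl
  · have h1 : N⁻¹ * N' = 1 := Subtype.ext (by rw [← hrN]; simp)
    exact Or.inl (inv_mul_eq_one.mp h1)
  · have h1 : N⁻¹ * N' = -1 := Subtype.ext (by rw [← hrN, map_neg, map_one]; rfl)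
    rw [inv_mul_eq_iff_eq_mul] at h1
    exact Or.inr (by simp [h1])

theorem toPSL_eq_of {N N' : SpecialLinearGroup (Fin 2) (ZMod 7)} (h : N = N' ∨ N = -N') :
    toPSL N = toPSL N' := by
  rcases h with rfl | rfl
  exacts [rfl, toPSL_neg _]

theorem closure_toPSL_eq_top :
    Subgroup.closure (Set.range fun k => toPSL (involMat (genIndex k))) = ⊤ := by
  set H := Subgroup.closure (Set.range fun k => toPSL (involMat (genIndex k)))
  have gen_mem : ∀ k, toPSL (involMat (genIndex k)) ∈ H := fun k =>
    Subgroup.subset_closure (Set.mem_range_self k)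
  have h0 : toPSL (involMat 0) ∈ H := gen_mem 0
  have h1 : toPSL (involMat 1) ∈ H := gen_mem 1
  have h2 : toPSL (involMat 2) ∈ H := gen_mem 2
  have htransvec : ∀ (i j : Fin 2) (hij : i ≠ j) (b : ZMod 7),
      toPSL (SpecialLinearGroup.transvection hij b) ∈ H := by
    intro i j hij b
    obtain ⟨n, h | h | h | h⟩ := transvection_eq_pow b i j hij <;>
      rw [h] <;> simp only [toPSL_neg, map_pow, map_mul]
    · exact pow_mem (mul_mem (mul_mem h0 h1) h2) _
    · exact pow_mem (mul_mem (mul_mem h0 h1) h2) _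
    · exact pow_mem (mul_mem (mul_mem h0 h2) h1) _
    · exact pow_mem (mul_mem (mul_mem h0 h2) h1) _
  have hmul : ∀ N N' : SpecialLinearGroup (Fin 2) (ZMod 7), toPSL N ∈ H → toPSL N' ∈ H →
      toPSL (N * N') ∈ H := fun N N' hN hN' => by
    rw [map_mul]
    exact mul_mem hN hN'
  have : Fact (Nat.Prime 7) := ⟨by norm_num⟩
  rw [eq_top_iff]
  rintro g -
  obtain ⟨N, rfl⟩ := toPSL_surjective g
  exact SL2.transvection_induction (F := ZMod 7) (fun N => toPSL N ∈ H) htransvec hmul N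

theorem nonempty_PSL_mulEquiv : Nonempty (ProjectiveSpecialLinearGroup (Fin 2) (ZMod 7) ≃*
    Subgroup.closure (Set.range invol)) := by
  have key : Nonempty (Subgroup.closure (Set.range fun k => toPSL (involMat (genIndex k))) ≃*
      Subgroup.closure (Set.range invol)) := by
    refine nonempty_closure_mulEquiv ((MulAut.toPerm _).comp MulAut.conj)
      (p := fun i => toPSL (involMat i))
      (fun i j h => involMat_injective i j (eq_or_of_toPSL_eq h)) _ _ ?_ ?_
    · intro k i
      have h1 := toPSL_eq_of (involMat_conj k i)
      simp only [map_mul] at h1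
      exact mul_inv_eq_iff_eq_mul.mpr h1
    · intro g _ hg
      obtain ⟨N, rfl⟩ := toPSL_surjective g
      have h1 : ∀ k, N * involMat (genIndex k) = involMat (genIndex k) * N ∨
          N * involMat (genIndex k) = -(involMat (genIndex k) * N) := by
        intro k
        refine eq_or_of_toPSL_eq ?_
        simp only [map_mul]
        -- The generators are themselves among the 21 points, so fixing them means commuting with
        -- them.
        exact mul_inv_eq_iff_eq_mul.mp (hg (genIndex k))
      have h2 : N.1 = !![N.1 0 0, N.1 0 1; N.1 1 0, N.1 1 1] := eta_fin_two _
      have h3 := eq_one_or_of_commute (N.1 0 0) (N.1 0 1) (N.1 1 0) (N.1 1 1)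
        (by rw [← det_fin_two]; exact N.2) (fun k => by
          rw [← h2]
          exact (h1 k).imp (congrArg Subtype.val) (congrArg Subtype.val))
      rw [← h2] at h3
      rw [← map_one toPSL]
      exact toPSL_eq_of (h3.imp (fun h => Subtype.ext h) (fun h => Subtype.ext h))
  obtain ⟨f⟩ := key
  rw [closure_toPSL_eq_top] at f
  exact ⟨Subgroup.topEquiv.symm.trans f⟩

end SpecialLinear

/-! ### Transfer from the model to an arbitrary universal algebra. -/

section Klein

variable {A : Type u} [NonUnitalNonAssocCommRing A] [Module ℝ A]
  [IsScalarTower ℝ A A] [SMulCommClass ℝ A A] {φ : LinearMap.BilinForm ℝ A}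
  {a b c : A} {α β γ ψ : ℝ}

theorem Model.miyamoto_eval (h : IsThreeGenerated φ a b c α β γ ψ) {e : Model.{u} α β γ ψ}
    (he : IsAxis e) {e' : A} (he' : IsAxis e') (hee : eval h e = e') (x : Model.{u} α β γ ψ) :
    miyamoto he' (eval h x) = eval h (miyamoto he x) := by
  subst hee
  simp only [h.pc.miyamoto_apply, isPseudoComposition.miyamoto_apply, map_add, map_sub, map_smul,
    map_mul, form_eval]

/-- The map to the model supplied by universality is a left inverse, since it returns the generators
and hence all eight basis monomials. The 21 axes therefore stay distinct in the algebra. -/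
theorem IsUniversal.eval_injective (h : IsUniversal φ a b c α β γ ψ) :
    Function.Injective (Model.eval.{u} h.toIsThreeGenerated) := by
  obtain ⟨g, -, ha, hb, hc⟩ := h.universal _ _ _ _ _ (Model.isThreeGenerated α β γ ψ)
  have key : ∀ x, g (Model.eval h.toIsThreeGenerated x) = x := by
    intro x
    refine Eq.trans ?_ (Model.eq_combination x).symm
    conv_lhs => rw [Model.eq_combination x]
    simp only [map_add, map_smul, map_mul, Model.eval_genA, Model.eval_genB, Model.eval_genC,
      ha, hb, hc]
  exact Function.LeftInverse.injective key

/-- Elements of the group generated by the Miyamoto involutions are automorphisms. -/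
theorem map_mul_of_mem_tripleGroup {ha : IsAxis a} {hb : IsAxis b} {hc : IsAxis c} {g : A ≃ₗ[ℝ] A}
    (hg : g ∈ tripleGroup ha hb hc) (x y : A) : g (x * y) = g x * g y := by
  induction hg using Subgroup.closure_induction generalizing x y with
  | mem g hg =>
    rcases hg with rfl | rfl | rfl <;> exact miyamoto_mul _ x y
  | one => rfl
  | mul g g' _ _ h1 h2 => simp [h1, h2]
  | inv g _ h1 =>
    apply g.injective
    have key : ∀ z, g (g⁻¹ z) = z := g.apply_symm_apply
    rw [h1, key, key, key]

/-- An automorphism in the group fixing the three generators is trivial. -/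
theorem IsThreeGenerated.eq_one_of_fix (h : IsThreeGenerated φ a b c α β γ ψ) {g : A ≃ₗ[ℝ] A}
    (hg : ∀ x y, g (x * y) = g x * g y) (ha : g a = a) (hb : g b = b) (hc : g c = c) : g = 1 := by
  ext x
  have hx : x ∈ NonUnitalAlgebra.adjoin ℝ {a, b, c} := by simp [h.gen]
  induction hx using NonUnitalAlgebra.adjoin_induction with
  | mem x hx =>
    rcases hx with rfl | rfl | rfl
    exacts [ha, hb, hc]
  | zero => simp
  | add x z _ _ h1 h2 => rw [map_add, h1, h2, map_add]
  | smul r x _ h1 => rw [map_smul, h1, map_smul]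
  | mul x z _ _ h1 h2 => rw [hg, h1, h2]; rfl

theorem IsUniversal.nonempty_PSL_mulEquiv
    (h : IsUniversal φ a b c (1 / 4) (1 / 4) (1 / 4) (5 / 32)) :
    Nonempty (tripleGroup h.axis_a h.axis_b h.axis_c ≃*
      Matrix.ProjectiveSpecialLinearGroup (Fin 2) (ZMod 7)) := by
  have h3 := h.toIsThreeGenerated
  let t : Fin 3 → A ≃ₗ[ℝ] A := ![miyamoto h.axis_a, miyamoto h.axis_b, miyamoto h.axis_c]
  have ht : Subgroup.closure (Set.range t) = tripleGroup h.axis_a h.axis_b h.axis_c := by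
    rw [tripleGroup]
    congr 1
    ext x
    simp [t]
    tauto
  have nine : ∀ {x : A} {g : A ≃ₗ[ℝ] A}, g ((9 : ℝ) • x) = (9 : ℝ) • x → g x = x := by
    intro x g hx
    rw [map_smul] at hx
    exact smul_right_injective A (by norm_num : (9 : ℝ) ≠ 0) hx
  have axa : Model.eval h3 (Model.axis 0) = (9 : ℝ) • a := by
    rw [show Model.axis.{u} 0 = (9 : ℝ) • Model.genA _ _ _ _ by
      ext j; fin_cases j <;> simp [Model.axis, axisVec], map_smul, Model.eval_genA]
  have axb : Model.eval h3 (Model.axis 1) = (9 : ℝ) • b := by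
    rw [show Model.axis.{u} 1 = (9 : ℝ) • Model.genB _ _ _ _ by
      ext j; fin_cases j <;> simp [Model.axis, axisVec], map_smul, Model.eval_genB]
  have axc : Model.eval h3 (Model.axis 2) = (9 : ℝ) • c := by
    rw [show Model.axis.{u} 2 = (9 : ℝ) • Model.genC _ _ _ _ by
      ext j; fin_cases j <;> simp [Model.axis, axisVec], map_smul, Model.eval_genC]
  have key : Nonempty (Subgroup.closure (Set.range t) ≃* Subgroup.closure (Set.range invol)) := by
    refine nonempty_closure_mulEquiv (MulAction.toPermHom (A ≃ₗ[ℝ] A) A)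
      (p := fun i => Model.eval h3 (Model.axis.{u} i))
      (h.eval_injective.comp Model.axis_injective) t invol ?_ ?_
    · intro k i
      change t k (Model.eval h3 (Model.axis i)) = Model.eval h3 (Model.axis (involFun k i))
      fin_cases k
      · exact (Model.miyamoto_eval h3 _ h.axis_a (Model.eval_genA h3) _).trans
          (congrArg _ (Model.miyamoto_genA_axis i))
      · exact (Model.miyamoto_eval h3 _ h.axis_b (Model.eval_genB h3) _).trans
          (congrArg _ (Model.miyamoto_genB_axis i))
      · exact (Model.miyamoto_eval h3 _ h.axis_c (Model.eval_genC h3) _).trans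
          (congrArg _ (Model.miyamoto_genC_axis i))
    · intro g hg hfix
      rw [ht] at hg
      have hfix' : ∀ i, g (Model.eval h3 (Model.axis i)) = Model.eval h3 (Model.axis i) := hfix
      exact h3.eq_one_of_fix (map_mul_of_mem_tripleGroup hg) (nine (axa ▸ hfix' 0))
        (nine (axb ▸ hfix' 1)) (nine (axc ▸ hfix' 2))
  obtain ⟨f⟩ := key
  obtain ⟨f'⟩ := PCAlg.nonempty_PSL_mulEquiv
  rw [ht] at f
  exact ⟨f.trans f'.symm⟩

end Klein

end PCAlg

theorem mainTheorem8 :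
    -- for all real parameters the universal algebra exists
    (∀ α β γ ψ : ℝ, ∃ (A : Type u) (_ : NonUnitalNonAssocCommRing A) (_ : Module ℝ A)
      (_ : IsScalarTower ℝ A A) (_ : SMulCommClass ℝ A A)
      (φ : LinearMap.BilinForm ℝ A) (a b c : A), PCAlg.IsUniversal φ a b c α β γ ψ) ∧
    -- for no parameters do the three Miyamoto involutions generate `A₅`
    (∀ (α β γ ψ : ℝ) (A : Type u) [NonUnitalNonAssocCommRing A] [Module ℝ A]
      [IsScalarTower ℝ A A] [SMulCommClass ℝ A A]
      (φ : LinearMap.BilinForm ℝ A) (a b c : A) (h : PCAlg.IsUniversal φ a b c α β γ ψ),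
      ¬ Nonempty (PCAlg.tripleGroup h.axis_a h.axis_b h.axis_c ≃* alternatingGroup (Fin 5))) ∧
    -- for `α = β = γ = 1/4` and `ψ = 5/32` they generate `PSL(2, 7)`
    (∀ (A : Type u) [NonUnitalNonAssocCommRing A] [Module ℝ A]
      [IsScalarTower ℝ A A] [SMulCommClass ℝ A A]
      (φ : LinearMap.BilinForm ℝ A) (a b c : A)
      (h : PCAlg.IsUniversal φ a b c (1 / 4) (1 / 4) (1 / 4) (5 / 32)),
      Nonempty (PCAlg.tripleGroup h.axis_a h.axis_b h.axis_c ≃*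
        Matrix.ProjectiveSpecialLinearGroup (Fin 2) (ZMod 7))) := by
  refine ⟨fun α β γ ψ => ?_, ?_, ?_⟩
  · exact ⟨PCAlg.Model.{u} α β γ ψ, inferInstance, inferInstance, inferInstance, inferInstance, _,
      _, _, _, PCAlg.Model.isUniversal α β γ ψ⟩
  · intro α β γ ψ A _ _ _ _ φ a b c h
    exact h.not_alternating
  · intro A _ _ _ _ φ a b c h
    exact h.nonempty_PSL_mulEquiv
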